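/- Work in intuitionistic first-order logic with equality, with connectives $\land,\lor,\to,\exists,\forall,\bot$ (and $\neg\varphi := \varphi\to\bot$), in the language of arithmetic with a function symbol for every primitive recursive function. Heyting arithmetic $\mathbf{HA}$ is the theory whose axioms are the successor axioms, the defining equations of the primitive recursive functions, and induction for all formulas. Let $\Sigma_0=\Pi_0$ be the set of quantifier-free formulas and, for $k\ge 0$, $$\Sigma_{k+1}=\{\exists x_1\cdots\exists x_n\,\varphi \mid n\ge 1,\ \varphi\in\Pi_k\},\qquad \Pi_{k+1}=\{\forall x_1\cdots\forall x_n\,\varphi \mid n\ge 1,\ \varphi\in\Sigma_k\};$$ put $\Sigma_m=\Pi_m=\emptyset$ for $m<0$. For a set $\Gamma$ of formulas (which may have free variables), let $\mathrm{DML}_\Gamma$ be the scheme $\neg(\varphi\land\psi)\to\neg\varphi\lor\neg\psi$ for $\varphi,\psi\in\Gamma$, and $\mathrm{DNE}_\Gamma$ the scheme $\neg\neg\varphi\to\varphi$ for $\varphi\in\Gamma$. For a theory $T$ and a scheme $P$, $T+P$ is $T$ together with the universal closures of all instances of $P$, and $T\vdash P$ means that $T$ proves every instance of $P$. Proposition.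 For every natural number $k\ge 0$, $$\mathbf{HA}+\mathrm{DML}_{\Sigma_k}+\mathrm{DNE}_{\Sigma_{k-1}}\vdash \mathrm{DML}_{\Pi_k}.$$ -/

import Mathlib

namespace HeytingArith

/-! ## Language -/

/-- Function symbols for the primitive recursive functions: one symbol of arity `n` for every
definition of an `n`-ary primitive recursive function from zero, successor, projections,
composition and primitive recursion. -/
inductive PrimRecSymb : ℕ → Type
  | zero : PrimRecSymb 0
  | succ : PrimRecSymb 1
  | proj {n : ℕ} (i : Fin n) : PrimRecSymb n
  | comp {m n : ℕ} (f : PrimRecSymb m) (g : Fin m → PrimRecSymb n) : PrimRecSymb n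
  | prec {n : ℕ} (f : PrimRecSymb n) (g : PrimRecSymb (n + 2)) : PrimRecSymb (n + 1)

/-- The language of arithmetic. Equality, the only predicate, is a primitive of the formulas. -/
def arith : FirstOrder.Language.{0, 0} := ⟨PrimRecSymb, fun _ => Empty⟩

/-- Terms whose variables are among `x₀, …, xₙ₋₁`. -/
abbrev Tm (n : ℕ) : Type := arith.Term (Fin n)

/-- Application of a primitive recursive function symbol. -/
def app {n m : ℕ} (f : PrimRecSymb m) (ts : Fin m → Tm n) : Tm n :=
  FirstOrder.Language.Term.func (L := arith) f ts

/-- The variable `xᵢ`. -/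
def v {n : ℕ} (i : Fin n) : Tm n := FirstOrder.Language.Term.var i

/-- The constant `0`. -/
def zeroTm {n : ℕ} : Tm n := app .zero Fin.elim0

/-- The successor of a term. -/
def succTm {n : ℕ} (t : Tm n) : Tm n := app .succ (fun _ => t)

/-- First-order formulas of arithmetic whose free variables are among `x₀, …, xₙ₋₁`, with all the
intuitionistic connectives primitive. A quantifier binds the variable `x₀` of its scope, and
`xᵢ₊₁` in the scope is `xᵢ` outside. -/
inductive Formula : ℕ → Type
  | bot {n : ℕ} : Formula n
  | eq {n : ℕ} (s t : Tm n) : Formula n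
  | and {n : ℕ} (φ ψ : Formula n) : Formula n
  | or {n : ℕ} (φ ψ : Formula n) : Formula n
  | imp {n : ℕ} (φ ψ : Formula n) : Formula n
  | all {n : ℕ} (φ : Formula (n + 1)) : Formula n
  | ex {n : ℕ} (φ : Formula (n + 1)) : Formula n

/-- The formula `φ → ⊥`. -/
def Formula.neg {n : ℕ} (φ : Formula n) : Formula n := .imp φ .bot

/-- Sentences. -/
abbrev Sentence : Type := Formula 0

/-- A simultaneous substitution carried under one quantifier. -/
def liftSubst {n m : ℕ} (σ : Fin n → Tm m) : Fin (n + 1) → Tm (m + 1) :=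
  Fin.cons (v 0) (fun i => (σ i).relabel Fin.succ)

/-- Simultaneous capture-avoiding substitution of terms for the free variables. -/
def Formula.subst : {n m : ℕ} → Formula n → (Fin n → Tm m) → Formula m
  | _, _, .bot, _ => .bot
  | _, _, .eq s t, σ => .eq (FirstOrder.Language.Term.subst s σ) (FirstOrder.Language.Term.subst t σ)
  | _, _, .and φ ψ, σ => .and (φ.subst σ) (ψ.subst σ)
  | _, _, .or φ ψ, σ => .or (φ.subst σ) (ψ.subst σ)
  | _, _, .imp φ ψ, σ => .imp (φ.subst σ) (ψ.subst σ)
  | _, _, .all φ, σ => .all (φ.subst (liftSubst σ))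
  | _, _, .ex φ, σ => .ex (φ.subst (liftSubst σ))

/-- The same formula regarded in a context with one further variable, put in front. -/
def Formula.shift {n : ℕ} (φ : Formula n) : Formula (n + 1) :=
  φ.subst (fun i => v i.succ)

/-- Substitution of `t` for `x₀`, the variable that a quantifier in front of `φ` would bind. -/
def Formula.inst {n : ℕ} (φ : Formula (n + 1)) (t : Tm n) : Formula n :=
  φ.subst (Fin.cons t v)

/-- Universal closure. -/
def Formula.close : {n : ℕ} → Formula n → Sentence
  | 0, φ => φ
  | _ + 1, φ => φ.all.close

/-! ## Intuitionistic derivability -/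

/-- `Derives T Γ φ`: the formula `φ` is derivable from the (closed) axioms `T` and the assumptions
`Γ` in intuitionistic first-order logic with equality (natural deduction). -/
inductive Derives (T : Set Sentence) : {n : ℕ} → List (Formula n) → Formula n → Prop
  | ax {n : ℕ} {Γ : List (Formula n)} {σ : Sentence} :
      σ ∈ T → Derives T Γ (σ.subst Fin.elim0)
  | hyp {n : ℕ} {Γ : List (Formula n)} {φ : Formula n} : φ ∈ Γ → Derives T Γ φ
  | botE {n : ℕ} {Γ : List (Formula n)} {φ : Formula n} :
      Derives T Γ .bot → Derives T Γ φ
  | andI {n : ℕ} {Γ : List (Formula n)} {φ ψ : Formula n} :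
      Derives T Γ φ → Derives T Γ ψ → Derives T Γ (.and φ ψ)
  | andE₁ {n : ℕ} {Γ : List (Formula n)} {φ ψ : Formula n} :
      Derives T Γ (.and φ ψ) → Derives T Γ φ
  | andE₂ {n : ℕ} {Γ : List (Formula n)} {φ ψ : Formula n} :
      Derives T Γ (.and φ ψ) → Derives T Γ ψ
  | orI₁ {n : ℕ} {Γ : List (Formula n)} {φ ψ : Formula n} :
      Derives T Γ φ → Derives T Γ (.or φ ψ)
  | orI₂ {n : ℕ} {Γ : List (Formula n)} {φ ψ : Formula n} :
      Derives T Γ ψ → Derives T Γ (.or φ ψ)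
  | orE {n : ℕ} {Γ : List (Formula n)} {φ ψ χ : Formula n} :
      Derives T Γ (.or φ ψ) → Derives T (φ :: Γ) χ → Derives T (ψ :: Γ) χ → Derives T Γ χ
  | impI {n : ℕ} {Γ : List (Formula n)} {φ ψ : Formula n} :
      Derives T (φ :: Γ) ψ → Derives T Γ (.imp φ ψ)
  | impE {n : ℕ} {Γ : List (Formula n)} {φ ψ : Formula n} :
      Derives T Γ (.imp φ ψ) → Derives T Γ φ → Derives T Γ ψ
  | allI {n : ℕ} {Γ : List (Formula n)} {φ : Formula (n + 1)} :
      Derives T (Γ.map Formula.shift) φ → Derives T Γ (.all φ)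
  | allE {n : ℕ} {Γ : List (Formula n)} {φ : Formula (n + 1)} (t : Tm n) :
      Derives T Γ (.all φ) → Derives T Γ (φ.inst t)
  | exI {n : ℕ} {Γ : List (Formula n)} {φ : Formula (n + 1)} (t : Tm n) :
      Derives T Γ (φ.inst t) → Derives T Γ (.ex φ)
  | exE {n : ℕ} {Γ : List (Formula n)} {φ : Formula (n + 1)} {χ : Formula n} :
      Derives T Γ (.ex φ) → Derives T (φ :: Γ.map Formula.shift) χ.shift → Derives T Γ χ
  | eqRefl {n : ℕ} {Γ : List (Formula n)} (t : Tm n) : Derives T Γ (.eq t t)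
  | eqSubst {n : ℕ} {Γ : List (Formula n)} {s t : Tm n} (φ : Formula (n + 1)) :
      Derives T Γ (.eq s t) → Derives T Γ (φ.inst s) → Derives T Γ (φ.inst t)

/-! ## Sets of formulas, theories and principles -/

/-- A set of formulas, sorted by the variable context: `Γ n` holds its members whose free
variables are among `x₀, …, xₙ₋₁`. -/
abbrev FormulaSet : Type := (n : ℕ) → Set (Formula n)

/-- The theory whose axioms are the universal closures of the formulas in `P`. -/
def closures (P : FormulaSet) : Set Sentence := {σ | ∃ n, ∃ φ ∈ P n, σ = Formula.close φ}

/-- The theory `T + P`: the universal closures of all instances of `P` are added as axioms. -/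
def plus (T : Set Sentence) (P : FormulaSet) : Set Sentence := T ∪ closures P

/-- The theory `T` proves (every instance of) the principle `P`. -/
def Proves (T : Set Sentence) (P : FormulaSet) : Prop :=
  ∀ (n : ℕ) (φ : Formula n), φ ∈ P n → Derives T [] φ

/-- Nonlogical axioms of Heyting arithmetic, before universal closure: the successor axioms, the
defining equations of the primitive recursive functions, and the induction scheme. -/
inductive HAAxiom : {n : ℕ} → Formula n → Prop
  | succ_ne_zero : HAAxiom (n := 1) (Formula.neg (.eq (succTm (v 0)) zeroTm))
  | succ_inj :
      HAAxiom (n := 2) (.imp (.eq (succTm (v 0)) (succTm (v 1))) (.eq (v 0) (v 1)))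
  | proj {n : ℕ} (i : Fin n) : HAAxiom (.eq (app (.proj i) v) (v i))
  | comp {m n : ℕ} (f : PrimRecSymb m) (g : Fin m → PrimRecSymb n) :
      HAAxiom (n := n) (.eq (app (.comp f g) v) (app f (fun j => app (g j) v)))
  | prec_zero {n : ℕ} (f : PrimRecSymb n) (g : PrimRecSymb (n + 2)) :
      HAAxiom (n := n) (.eq (app (.prec f g) (Fin.cons zeroTm v)) (app f v))
  | prec_succ {n : ℕ} (f : PrimRecSymb n) (g : PrimRecSymb (n + 2)) :
      HAAxiom (n := n + 1)
        (.eq (app (.prec f g) (Fin.cons (succTm (v 0)) (fun i => v i.succ)))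
          (app g (Fin.cons (v 0) (Fin.cons (app (.prec f g) v) (fun i => v i.succ)))))
  | induction {n : ℕ} (φ : Formula (n + 1)) :
      HAAxiom (.imp
        (.and (φ.inst zeroTm)
          (.all (.imp φ (φ.subst (Fin.cons (succTm (v 0)) (fun i => v i.succ))))))
        (.all φ))

/-- Heyting arithmetic. -/
def HA : Set Sentence := closures (fun _ => {φ | HAAxiom φ})

/-- De Morgan's law for formulas in `Γ`: `¬(φ ∧ ψ) → ¬φ ∨ ¬ψ`. -/
def DML (Γ : FormulaSet) : FormulaSet := fun n =>
  {χ | ∃ φ ∈ Γ n, ∃ ψ ∈ Γ n,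
    χ = .imp (Formula.neg (.and φ ψ)) (.or (Formula.neg φ) (Formula.neg ψ))}

/-- Double negation elimination for formulas in `Γ`: `¬¬φ → φ`. -/
def DNE (Γ : FormulaSet) : FormulaSet := fun n =>
  {χ | ∃ φ ∈ Γ n, χ = .imp (Formula.neg (Formula.neg φ)) φ}

/-! ## The arithmetical hierarchy of formulas -/

/-- Quantifier-free formulas. -/
def Formula.IsQF : {n : ℕ} → Formula n → Prop
  | _, .bot => True
  | _, .eq _ _ => True
  | _, .and φ ψ => φ.IsQF ∧ ψ.IsQF
  | _, .or φ ψ => φ.IsQF ∧ ψ.IsQF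
  | _, .imp φ ψ => φ.IsQF ∧ ψ.IsQF
  | _, .all _ => False
  | _, .ex _ => False

/-- A block of `m` existential quantifiers. -/
def exs {n : ℕ} : (m : ℕ) → Formula (n + m) → Formula n
  | 0, φ => φ
  | m + 1, φ => exs m (.ex φ)

/-- A block of `m` universal quantifiers. -/
def alls {n : ℕ} : (m : ℕ) → Formula (n + m) → Formula n
  | 0, φ => φ
  | m + 1, φ => alls m (.all φ)

mutual
/-- `φ` is a `Σₖ` formula. -/
def IsSigma : (k : ℕ) → {n : ℕ} → Formula n → Prop
  | 0, _, φ => φ.IsQF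
  | k + 1, n, φ => ∃ m : ℕ, 1 ≤ m ∧ ∃ ψ : Formula (n + m), IsPi k ψ ∧ φ = exs m ψ
/-- `φ` is a `Πₖ` formula. -/
def IsPi : (k : ℕ) → {n : ℕ} → Formula n → Prop
  | 0, _, φ => φ.IsQF
  | k + 1, n, φ => ∃ m : ℕ, 1 ≤ m ∧ ∃ ψ : Formula (n + m), IsSigma k ψ ∧ φ = alls m ψ
end

/-- The set of `Σₖ` formulas, empty for negative `k`. -/
def SigmaSet : ℤ → FormulaSet
  | .ofNat k => fun _ => {φ | IsSigma k φ}
  | .negSucc _ => fun _ => ∅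

/-- The set of `Πₖ` formulas, empty for negative `k`. -/
def PiSet : ℤ → FormulaSet
  | .ofNat k => fun _ => {φ | IsPi k φ}
  | .negSucc _ => fun _ => ∅

end HeytingArith

-- For `k = 0` there is nothing to prove, since `Σ₀ = Π₀`. At level `k + 1`, double negation
-- elimination is available for `Σₖ`. Contract the quantifier blocks, so that the two formulas are
-- `∀ x, A x` and `∀ y, B y` with `A`, `B` in `Σₖ`, and suppose that they are not both true. Let two
-- searches for a counterexample race: `P = ∃ x, ¬A x ∧ ∀ y < x, B y` and `Q = ∃ y, ¬B y ∧ (∀ x < y,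
-- A x) ∧ A y`. Comparing the witnesses `x` and `y` shows that `P ∧ Q` is absurd; the conjunct `A y`
-- settles the tie. De Morgan's law for `P` and `Q` gives `¬P ∨ ¬Q`. Under `¬P`, if `∀ y, B y` then
-- no `x` has `¬A x`, so `∀ x, A x` by stability of `A`, a contradiction; hence `¬∀ y, B y`.
-- Symmetrically, `¬Q` yields `¬∀ x, A x`. No least counterexample is ever needed
-- (`Force.deMorgan_all`).
--
-- The work lies in showing that `P` and `Q` are `Σₖ₊₁` up to provable equivalence. Stability of
-- `Σₖ` makes negation exchange `Σⱼ` and `Πⱼ` for `j ≤ k` (`neg_mem_hierarchy`). Bounded universal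
-- quantification preserves `Σⱼ` (`ballClosed_sigmaCl`): by primitive recursive characteristic
-- functions for `j = 0`, by collection (`Equivalent.collection`) and duality above. Blocks of
-- quantifiers are contracted by bounding them with one variable instead of coding pairs
-- (`Equivalent.ex_ex`, `Equivalent.all_all`).
--
-- Derivations inside the theory are replaced by reasoning about `Force`, which is derivability
-- itself, but obeys the Kripke clauses for `∧`, `→`, `∀` and elimination rules for `∨`, `∃`. A
-- formal proof then reads like an ordinary constructive argument.

namespace HeytingArith

open FirstOrder.Language Filter

/-! ## Substitution -/

theorem term_subst_subst {α β γ : Type} (t : arith.Term α) (σ : α → arith.Term β)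
    (τ : β → arith.Term γ) :
    (t.subst σ).subst τ = t.subst (fun i => (σ i).subst τ) := by
  induction t with
  | var i => rfl
  | func f ts ih => simp only [Term.subst, ih]

theorem term_relabel_eq_subst {α β : Type} (t : arith.Term α) (g : α → β) :
    t.relabel g = t.subst (fun i => Term.var (g i)) := by
  induction t with
  | var i => rfl
  | func f ts ih => simp only [Term.subst, Term.relabel, ih]

theorem term_subst_var {α : Type} (t : arith.Term α) : t.subst Term.var = t := by
  induction t with
  | var i => rfl
  | func f ts ih => simp only [Term.subst, ih]

@[simp] theorem v_subst {n : ℕ} {α : Type} (i : Fin n) (σ : Fin n → arith.Term α) :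
    (v i).subst σ = σ i := rfl

theorem liftSubst_subst {n m p : ℕ} (σ : Fin n → Tm m) (τ : Fin m → Tm p) :
    (fun i => (liftSubst σ i).subst (liftSubst τ)) = liftSubst (fun i => (σ i).subst τ) := by
  funext i
  refine Fin.cases rfl (fun j => ?_) i
  simp only [liftSubst, Fin.cons_succ, term_relabel_eq_subst, term_subst_subst]
  rfl

theorem Formula.subst_subst {n m p : ℕ} (φ : Formula n) (σ : Fin n → Tm m) (τ : Fin m → Tm p) :
    (φ.subst σ).subst τ = φ.subst (fun i => (σ i).subst τ) := by
  induction φ generalizing m p with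
  | bot => rfl
  | eq s t => simp only [Formula.subst, term_subst_subst]
  | and φ ψ ih1 ih2 => simp only [Formula.subst, ih1, ih2]
  | or φ ψ ih1 ih2 => simp only [Formula.subst, ih1, ih2]
  | imp φ ψ ih1 ih2 => simp only [Formula.subst, ih1, ih2]
  | all φ ih => simp only [Formula.subst, ih, liftSubst_subst]
  | ex φ ih => simp only [Formula.subst, ih, liftSubst_subst]

theorem liftSubst_v {n : ℕ} : liftSubst (v : Fin n → Tm n) = v := by
  funext i
  exact Fin.cases rfl (fun j => rfl) i

theorem Formula.subst_v {n : ℕ} (φ : Formula n) : φ.subst v = φ := by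
  induction φ with
  | bot => rfl
  | eq s t => simp only [Formula.subst]; congr 1 <;> exact term_subst_var _
  | and φ ψ ih1 ih2 => simp only [Formula.subst, ih1, ih2]
  | or φ ψ ih1 ih2 => simp only [Formula.subst, ih1, ih2]
  | imp φ ψ ih1 ih2 => simp only [Formula.subst, ih1, ih2]
  | all φ ih => simp only [Formula.subst, liftSubst_v, ih]
  | ex φ ih => simp only [Formula.subst, liftSubst_v, ih]

theorem Formula.subst_liftSubst_inst {n m : ℕ} (φ : Formula (n + 1)) (σ : Fin n → Tm m)
    (t : Tm m) : (φ.subst (liftSubst σ)).inst t = φ.subst (Fin.cons t σ) := by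
  rw [Formula.inst, Formula.subst_subst]
  congr 1
  funext i
  refine Fin.cases rfl (fun j => ?_) i
  simp only [liftSubst, Fin.cons_succ, term_relabel_eq_subst, term_subst_subst]
  exact term_subst_var _

theorem Formula.inst_subst {n m : ℕ} (φ : Formula (n + 1)) (t : Tm n) (σ : Fin n → Tm m) :
    (φ.inst t).subst σ = (φ.subst (liftSubst σ)).inst (t.subst σ) := by
  rw [Formula.subst_liftSubst_inst, Formula.inst, Formula.subst_subst]
  congr 1
  funext i
  exact Fin.cases rfl (fun j => rfl) i

theorem Formula.shift_subst_liftSubst {n m : ℕ} (φ : Formula n) (σ : Fin n → Tm m) :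
    φ.shift.subst (liftSubst σ) = (φ.subst σ).shift := by
  simp only [Formula.shift, Formula.subst_subst]
  congr 1
  funext i
  simp only [v_subst, liftSubst, Fin.cons_succ, term_relabel_eq_subst]
  rfl

/-! ## Structural rules -/

theorem Derives.weaken {T : Set Sentence} {n : ℕ} {Γ : List (Formula n)} {φ : Formula n}
    (h : Derives T Γ φ) : ∀ {Δ : List (Formula n)}, Γ ⊆ Δ → Derives T Δ φ := by
  induction h with
  | ax h => exact fun _ => .ax h
  | hyp h => exact fun hs => .hyp (hs h)
  | botE _ ih => exact fun hs => .botE (ih hs)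
  | andI _ _ ih1 ih2 => exact fun hs => .andI (ih1 hs) (ih2 hs)
  | andE₁ _ ih => exact fun hs => .andE₁ (ih hs)
  | andE₂ _ ih => exact fun hs => .andE₂ (ih hs)
  | orI₁ _ ih => exact fun hs => .orI₁ (ih hs)
  | orI₂ _ ih => exact fun hs => .orI₂ (ih hs)
  | orE _ _ _ ih ih1 ih2 =>
    exact fun hs => .orE (ih hs) (ih1 (List.cons_subset_cons _ hs))
      (ih2 (List.cons_subset_cons _ hs))
  | impI _ ih => exact fun hs => .impI (ih (List.cons_subset_cons _ hs))
  | impE _ _ ih1 ih2 => exact fun hs => .impE (ih1 hs) (ih2 hs)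
  | allI _ ih => exact fun hs => .allI (ih (List.map_subset _ hs))
  | allE t _ ih => exact fun hs => .allE t (ih hs)
  | exI t _ ih => exact fun hs => .exI t (ih hs)
  | exE _ _ ih1 ih2 =>
    exact fun hs => .exE (ih1 hs) (ih2 (List.cons_subset_cons _ (List.map_subset _ hs)))
  | eqRefl t => exact fun _ => .eqRefl t
  | eqSubst φ _ _ ih1 ih2 => exact fun hs => .eqSubst φ (ih1 hs) (ih2 hs)

theorem map_shift_subst_liftSubst {n m : ℕ} (Γ : List (Formula n)) (σ : Fin n → Tm m) :
    (Γ.map Formula.shift).map (·.subst (liftSubst σ)) =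
      (Γ.map (·.subst σ)).map Formula.shift := by
  simp only [List.map_map]
  exact List.map_congr_left fun φ _ => φ.shift_subst_liftSubst σ

/-- This moves derivations between variable contexts; in particular it turns a derivation about a
fresh variable into a premise of `allI` or `exE`. -/
theorem Derives.subst {T : Set Sentence} {n : ℕ} {Γ : List (Formula n)} {φ : Formula n}
    (h : Derives T Γ φ) :
    ∀ {m : ℕ} (σ : Fin n → Tm m), Derives T (Γ.map (·.subst σ)) (φ.subst σ) := by
  induction h with
  | ax h =>
    intro m σ
    rw [Formula.subst_subst, Subsingleton.elim (fun i => _) Fin.elim0]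
    exact .ax h
  | hyp h => exact fun σ => .hyp (List.mem_map_of_mem h)
  | botE _ ih => exact fun σ => .botE (ih σ)
  | andI _ _ ih1 ih2 => exact fun σ => .andI (ih1 σ) (ih2 σ)
  | andE₁ _ ih => exact fun σ => .andE₁ (ih σ)
  | andE₂ _ ih => exact fun σ => .andE₂ (ih σ)
  | orI₁ _ ih => exact fun σ => .orI₁ (ih σ)
  | orI₂ _ ih => exact fun σ => .orI₂ (ih σ)
  | orE _ _ _ ih ih1 ih2 => exact fun σ => .orE (ih σ) (ih1 σ) (ih2 σ)
  | impI _ ih => exact fun σ => .impI (ih σ)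
  | impE _ _ ih1 ih2 => exact fun σ => .impE (ih1 σ) (ih2 σ)
  | allI _ ih =>
    intro m σ
    refine .allI ?_
    have := ih (liftSubst σ)
    rwa [map_shift_subst_liftSubst] at this
  | allE t _ ih =>
    intro m σ
    rw [Formula.inst_subst]
    exact .allE _ (ih σ)
  | exI t _ ih =>
    intro m σ
    have := ih σ
    rw [Formula.inst_subst] at this
    exact .exI _ this
  | exE _ _ ih1 ih2 =>
    intro m σ
    refine .exE (ih1 σ) ?_
    have := ih2 (liftSubst σ)
    rwa [List.map_cons, map_shift_subst_liftSubst, Formula.shift_subst_liftSubst] at this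
  | eqRefl t => exact fun σ => .eqRefl _
  | eqSubst φ _ _ ih1 ih2 =>
    intro m σ
    have h2 := ih2 σ
    rw [Formula.inst_subst] at h2 ⊢
    exact .eqSubst _ (ih1 σ) h2

/-! ## Forcing

Derivability is repackaged as a Kripke-style forcing relation, whose individuals are the terms in
infinitely many variables and whose worlds are finite lists of formulas with assignments. -/

/-- The individuals: terms with variables indexed by `ℕ`. -/
abbrev Elt : Type := arith.Term ℕ

/-- A formula together with an assignment for its free variables. -/
structure Assigned where
  /-- The number of free variables. -/
  arity : ℕ
  /-- The formula. -/
  formula : Formula arity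
  /-- The assignment. -/
  val : Fin arity → Elt

/-- Worlds are finite lists of assumptions. -/
abbrev World : Type := List Assigned

/-- The variables from `N` on are replaced by `0`. -/
def truncVar (N : ℕ) (i : ℕ) : Tm N := if h : i < N then v ⟨i, h⟩ else zeroTm

/-- The formula over `N` variables that an assigned formula denotes. -/
def Assigned.realize (N : ℕ) (c : Assigned) : Formula N :=
  c.formula.subst (fun i => (c.val i).subst (truncVar N))

/-- The formula `φ` under the assignment `ρ` is derivable from the assumptions in `w`, in all
sufficiently large variable contexts. -/
def Force (T : Set Sentence) (w : World) {n : ℕ} (φ : Formula n) (ρ : Fin n → Elt) : Prop :=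
  ∀ᶠ N in atTop, Derives T (w.map (Assigned.realize N)) (Assigned.realize N ⟨n, φ, ρ⟩)

/-- A term contains only finitely many variables. Freshness of `M` is expressed as independence of
the value substituted for it, so no set of free variables has to be defined. -/
theorem eventually_fresh_term (t : Elt) : ∀ᶠ M in atTop, ∀ (p : ℕ) (τ τ' : ℕ → Tm p),
    (∀ i, i ≠ M → τ i = τ' i) → t.subst τ = t.subst τ' := by
  induction t with
  | var i =>
    filter_upwards [eventually_gt_atTop i] with M hM p τ τ' h
    exact h i hM.ne
  | func f ts ih =>
    filter_upwards [eventually_all.2 ih] with M hM p τ τ' h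
    simp only [Term.subst]
    congr 1
    funext i
    exact hM i p τ τ' h

/-- Renames the variable with index `M` to `0` and moves the other ones up. -/
def freshSubst (N M : ℕ) (i : Fin N) : Tm (N + 1) := if (i : ℕ) = M then v 0 else v i.succ

theorem eventually_fresh {n : ℕ} (ρ : Fin n → Elt) : ∀ᶠ M in atTop, ∀ (N : ℕ),
    (fun i => ((ρ i).subst (truncVar N)).subst (freshSubst N M)) =
      (fun i => ((ρ i).subst (truncVar N)).subst (fun i => v i.succ)) := by
  filter_upwards [eventually_all.2 fun i => eventually_fresh_term (ρ i)] with M hM N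
  funext i
  simp only [term_subst_subst]
  refine hM i _ _ _ fun j hj => ?_
  unfold truncVar
  split
  · simp [freshSubst, hj]
  · simp only [zeroTm, app, Term.subst]
    congr 1
    funext i
    exact i.elim0

theorem eventually_fresh_world (w : World) : ∀ᶠ M in atTop, ∀ (N : ℕ),
    (w.map (Assigned.realize N)).map (·.subst (freshSubst N M)) =
      (w.map (Assigned.realize N)).map Formula.shift := by
  induction w with
  | nil => simp
  | cons c w ih =>
    filter_upwards [ih, eventually_fresh c.val] with M h1 h2 N
    simp only [List.map_cons, h1 N]
    congr 1
    simp only [Assigned.realize, Formula.shift, Formula.subst_subst, h2 N]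

namespace Force

variable {T : Set Sentence} {w w' : World} {n m : ℕ} {φ ψ : Formula n} {ρ : Fin n → Elt}
  {χ : Formula m} {ρ' : Fin m → Elt}

theorem mono (h : Force T w φ ρ) (hw : w ⊆ w') : Force T w' φ ρ :=
  Eventually.mono h fun _ h => h.weaken (List.map_subset _ hw)

theorem head : Force T (⟨n, φ, ρ⟩ :: w) φ ρ :=
  Eventually.of_forall fun _ => .hyp (by simp)

theorem botE {ρ : Fin n → Elt} (h : Force T w .bot ρ) : Force T w χ ρ' :=
  Eventually.mono h fun _ h => .botE h

theorem and_iff : Force T w (.and φ ψ) ρ ↔ Force T w φ ρ ∧ Force T w ψ ρ :=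
  ⟨fun h => ⟨Eventually.mono h fun _ h => .andE₁ h, Eventually.mono h fun _ h => .andE₂ h⟩,
    fun h => (h.1.and h.2).mono fun _ h => .andI h.1 h.2⟩

theorem orI₁ (h : Force T w φ ρ) : Force T w (.or φ ψ) ρ := Eventually.mono h fun _ h => .orI₁ h

theorem orI₂ (h : Force T w ψ ρ) : Force T w (.or φ ψ) ρ := Eventually.mono h fun _ h => .orI₂ h

/-- A world may force a disjunction without forcing either disjunct, so disjunctions are used only
through this rule, towards a goal that is itself forced; the same holds of `exE`. -/
theorem orE (h : Force T w (.or φ ψ) ρ) (h1 : ∀ w', w ⊆ w' → Force T w' φ ρ → Force T w' χ ρ')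
    (h2 : ∀ w', w ⊆ w' → Force T w' ψ ρ → Force T w' χ ρ') : Force T w χ ρ' := by
  filter_upwards [h, h1 (⟨n, φ, ρ⟩ :: w) (List.subset_cons_self _ _) head,
    h2 (⟨n, ψ, ρ⟩ :: w) (List.subset_cons_self _ _) head] with N h h1 h2
  exact .orE h h1 h2

/-- For the converse direction a single extension suffices: `w` with the assumption `φ` added. -/
theorem imp_iff :
    Force T w (.imp φ ψ) ρ ↔ ∀ w', w ⊆ w' → Force T w' φ ρ → Force T w' ψ ρ := by
  refine ⟨fun h w' hw h' => ?_, fun h => ?_⟩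
  · filter_upwards [h.mono hw, h'] with N h h'
    exact .impE h h'
  · filter_upwards [h (⟨n, φ, ρ⟩ :: w) (List.subset_cons_self _ _) head] with N h
    exact .impI h

theorem mp (h : Force T w (.imp φ ψ) ρ) (h' : Force T w φ ρ) : Force T w ψ ρ :=
  imp_iff.1 h w (List.Subset.refl _) h'

theorem neg_iff :
    Force T w (.neg φ) ρ ↔ ∀ w', w ⊆ w' → Force T w' φ ρ → Force T w' .bot Fin.elim0 :=
  imp_iff.trans ⟨fun h w' hw h' => (h w' hw h').botE, fun h w' hw h' => (h w' hw h').botE⟩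

theorem neg_elim (h : Force T w (.neg φ) ρ) (h' : Force T w φ ρ) : Force T w χ ρ' :=
  (neg_iff.1 h w (List.Subset.refl _) h').botE

theorem realize_cons (N : ℕ) (φ : Formula (n + 1)) (t : Elt) (ρ : Fin n → Elt) :
    Assigned.realize N ⟨n + 1, φ, Fin.cons t ρ⟩ =
      (φ.subst (liftSubst fun i => (ρ i).subst (truncVar N))).inst (t.subst (truncVar N)) := by
  rw [Formula.subst_liftSubst_inst, Assigned.realize]
  congr 1
  funext i
  exact Fin.cases rfl (fun j => rfl) i

theorem realize_cons_fresh {N M : ℕ} (hM : M < N) (φ : Formula (n + 1)) {ρ : Fin n → Elt}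
    (h : (fun i => ((ρ i).subst (truncVar N)).subst (freshSubst N M)) =
      (fun i => ((ρ i).subst (truncVar N)).subst (fun i => v i.succ))) :
    (Assigned.realize N ⟨n + 1, φ, Fin.cons (Term.var M) ρ⟩).subst (freshSubst N M) =
      φ.subst (liftSubst fun i => (ρ i).subst (truncVar N)) := by
  rw [Assigned.realize, Formula.subst_subst]
  congr 1
  funext i
  refine Fin.cases ?_ (fun j => ?_) i
  · simp [Term.subst, truncVar, hM, freshSubst, liftSubst]
  · simp only [Fin.cons_succ, liftSubst, term_relabel_eq_subst]
    exact congrFun h j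

theorem all_iff {φ : Formula (n + 1)} :
    Force T w (.all φ) ρ ↔ ∀ t, Force T w φ (Fin.cons t ρ) := by
  refine ⟨fun h t => ?_, fun h => ?_⟩
  · filter_upwards [h] with N h
    rw [realize_cons]
    exact .allE _ h
  -- The generic individual is a variable `M` that occurs neither in `w` nor in `ρ`; renaming it to
  -- the bound variable gives the premise of `allI`.
  · obtain ⟨M, h1, h2⟩ := ((eventually_fresh_world w).and (eventually_fresh ρ)).exists
    filter_upwards [h (Term.var M), eventually_gt_atTop M] with N h hM
    have := h.subst (freshSubst N M)
    rw [h1, realize_cons_fresh hM φ (h2 N)] at this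
    exact .allI this

theorem exI {φ : Formula (n + 1)} (t : Elt) (h : Force T w φ (Fin.cons t ρ)) :
    Force T w (.ex φ) ρ := by
  filter_upwards [h] with N h
  rw [realize_cons] at h
  exact .exI _ h

theorem exE {φ : Formula (n + 1)} (h : Force T w (.ex φ) ρ)
    (h' : ∀ w' t, w ⊆ w' → Force T w' φ (Fin.cons t ρ) → Force T w' χ ρ') : Force T w χ ρ' := by
  obtain ⟨M, h1, h2, h3⟩ := ((eventually_fresh_world w).and
    ((eventually_fresh ρ).and (eventually_fresh ρ'))).exists
  filter_upwards [h, h' (⟨n + 1, φ, Fin.cons (Term.var M) ρ⟩ :: w) (Term.var M)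
    (List.subset_cons_self _ _) head, eventually_gt_atTop M] with N h h' hM
  refine .exE h ?_
  have := h'.subst (freshSubst N M)
  rw [List.map_cons, List.map_cons, h1, realize_cons_fresh hM φ (h2 N)] at this
  convert this using 1
  simp only [Assigned.realize, Formula.shift, Formula.subst_subst, h3 N]

theorem subst_iff {τ : Fin n → Tm m} :
    Force T w (φ.subst τ) ρ' ↔ Force T w φ (fun i => (τ i).subst ρ') := by
  simp only [Force, Assigned.realize, Formula.subst_subst, term_subst_subst]

theorem eqRefl (t : Tm n) : Force T w (.eq t t) ρ := Eventually.of_forall fun _ => .eqRefl _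

theorem eqSubst {s t : Tm n} {χ : Formula (m + 1)} (h : Force T w (.eq s t) ρ)
    (h' : Force T w χ (Fin.cons (s.subst ρ) ρ')) : Force T w χ (Fin.cons (t.subst ρ) ρ') := by
  filter_upwards [h, h'] with N h h'
  rw [realize_cons] at h' ⊢
  simp only [Assigned.realize, Formula.subst, term_subst_subst] at h h' ⊢
  exact .eqSubst _ h h'

theorem axiom_close (h : φ.close ∈ T) (ρ : Fin n → Elt) : Force T w φ ρ := by
  have h0 : ∀ (m : ℕ) (χ : Formula m), Force T w χ.close Fin.elim0 → ∀ ρ, Force T w χ ρ := by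
    intro m
    induction m with
    | zero => exact fun χ h ρ => Subsingleton.elim Fin.elim0 ρ ▸ h
    | succ m ih =>
      intro χ h ρ
      rw [← Fin.cons_self_tail ρ]
      exact all_iff.1 (ih _ h _) _
  refine h0 n φ (Eventually.of_forall fun N => ?_) ρ
  rw [Assigned.realize, Subsingleton.elim (fun i => _) Fin.elim0]
  exact .ax h

/-- The identity assignment gives a derivation of `φ` in some context of size `N ≥ n`; putting `0`
for the superfluous variables brings it back to the context `n`. -/
theorem derives (h : ∀ ρ, Force T [] φ ρ) : Derives T [] φ := by
  obtain ⟨N, h, hN⟩ := ((h fun i => Term.var i).and (eventually_ge_atTop n)).exists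
  have := h.subst (fun i => if hi : (i : ℕ) < n then v ⟨i, hi⟩ else zeroTm)
  have e : (Assigned.realize N ⟨n, φ, fun i => Term.var i⟩).subst
      (fun i => if hi : (i : ℕ) < n then v ⟨i, hi⟩ else zeroTm) = φ := by
    rw [Assigned.realize, Formula.subst_subst]
    conv_rhs => rw [← φ.subst_v]
    congr 1
    funext i
    simp [Term.subst, truncVar, i.2.trans_le hN]
  rwa [e] at this

end Force

/-! ## Equality and the axioms of arithmetic in the forcing relation -/

/-- Application of a function symbol to individuals. -/
def ap {n : ℕ} (f : PrimRecSymb n) (ρ : Fin n → Elt) : Elt := Term.func (L := arith) f ρ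

/-- The individual `0`. -/
def zeroE : Elt := ap .zero Fin.elim0

/-- The successor of an individual. -/
def succE (a : Elt) : Elt := ap .succ (fun _ => a)

/-- A pair of arguments. -/
def pair {α : Type} (a b : α) : Fin 2 → α := Fin.cons a (Fin.cons b Fin.elim0)

theorem app_subst {n m : ℕ} (f : PrimRecSymb m) (ts : Fin m → Tm n) (ρ : Fin n → Elt) :
    (app f ts).subst ρ = ap f (fun i => (ts i).subst ρ) := rfl

@[simp] theorem zeroTm_subst {n : ℕ} (ρ : Fin n → Elt) : (zeroTm : Tm n).subst ρ = zeroE := by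
  rw [zeroTm, app_subst, zeroE]
  congr 1
  funext i
  exact i.elim0

@[simp] theorem succTm_subst {n : ℕ} (t : Tm n) (ρ : Fin n → Elt) :
    (succTm t).subst ρ = succE (t.subst ρ) := rfl

@[simp] theorem cons_at_two {α : Type} {n : ℕ} (a : α) (ρ : Fin (n + 2) → α) :
    (Fin.cons a ρ : Fin (n + 3) → α) 2 = ρ 1 := rfl

theorem pair_subst {n : ℕ} (s t : Tm n) (ρ : Fin n → Elt) :
    (fun i => (pair s t i).subst ρ) = pair (s.subst ρ) (t.subst ρ) := by
  funext i
  match i with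
  | 0 => rfl
  | 1 => rfl

theorem ap_pair {n : ℕ} (f g : PrimRecSymb n) (ρ : Fin n → Elt) :
    (fun i => ap ((Fin.cons f (Fin.cons g Fin.elim0) : Fin 2 → PrimRecSymb n) i) ρ) =
      pair (ap f ρ) (ap g ρ) := by
  funext i
  match i with
  | 0 => rfl
  | 1 => rfl

/-- Two individuals are forced to be equal. -/
def EqF (T : Set Sentence) (w : World) (a b : Elt) : Prop :=
  Force T w (.eq (v 0) (v 1)) (pair a b)

section Equality

variable {T : Set Sentence} {w w' : World} {n m : ℕ} {ρ ρ' : Fin n → Elt} {a b c : Elt}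

@[simp] theorem Force.eq_iff {s t : Tm n} :
    Force T w (.eq s t) ρ ↔ EqF T w (s.subst ρ) (t.subst ρ) := by
  simp only [EqF, Force, Assigned.realize, Formula.subst, v_subst, pair, Fin.cons_zero,
    Fin.cons_one, term_subst_subst]

theorem EqF.mono (h : EqF T w a b) (hw : w ⊆ w') : EqF T w' a b := Force.mono h hw

theorem EqF.refl (a : Elt) : EqF T w a a := Force.eq_iff.1 (Force.eqRefl (v 0) (ρ := pair a a))

theorem EqF.leibniz {φ : Formula (m + 1)} {ρ : Fin m → Elt} (h : EqF T w a b)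
    (h' : Force T w φ (Fin.cons a ρ)) : Force T w φ (Fin.cons b ρ) := Force.eqSubst h h'

theorem EqF.symm (h : EqF T w a b) : EqF T w b a :=
  h.leibniz (φ := .eq (v 0) (v 1)) (ρ := Fin.cons a Fin.elim0) (EqF.refl a)

theorem EqF.trans (h : EqF T w a b) (h' : EqF T w b c) : EqF T w a c :=
  h.symm.leibniz (φ := .eq (v 0) (v 1)) (ρ := Fin.cons c Fin.elim0) h'

theorem EqF.botE (h : Force T w .bot Fin.elim0) : EqF T w a b := Force.botE h

theorem EqF.zero_congr (h : EqF T w a b) : EqF T w a zeroE ↔ EqF T w b zeroE :=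
  ⟨h.symm.trans, h.trans⟩

/-- Leibniz's rule replaces only the front variable, so a new front variable takes the place of
coordinate `i`. -/
theorem Force.update {φ : Formula n} (i : Fin n) (h : Force T w φ ρ)
    (hb : EqF T w (ρ i) b) : Force T w φ (Function.update ρ i b) := by
  have key : ∀ c, (fun j => (if j = i then v 0 else v j.succ : Tm (n + 1)).subst
      (Fin.cons c ρ)) = Function.update ρ i c := by
    intro c
    funext j
    by_cases hj : j = i <;> simp [hj]
  rw [← key b, ← Force.subst_iff]
  refine hb.leibniz ?_
  rw [Force.subst_iff, key, Function.update_eq_self]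
  exact h

theorem Force.congr_val {φ : Formula n} (h : Force T w φ ρ) (he : ∀ i, EqF T w (ρ i) (ρ' i)) :
    Force T w φ ρ' := by
  -- The coordinates are exchanged one at a time.
  have key : ∀ s : Finset (Fin n), Force T w φ (fun i => if i ∈ s then ρ' i else ρ i) := by
    intro s
    induction s using Finset.induction_on with
    | empty => simpa using h
    | insert i s hi ih =>
      convert ih.update i (b := ρ' i) (by simpa [hi] using he i) using 1
      funext j
      by_cases hj : j = i
      · subst hj; simp
      · simp [hj]
  simpa using key Finset.univ

theorem EqF.ap_congr (f : PrimRecSymb n) (he : ∀ i, EqF T w (ρ i) (ρ' i)) :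
    EqF T w (ap f ρ) (ap f ρ') := by
  have h : Force T w (.eq (v 0) (app f fun i => v i.succ)) (Fin.cons (ap f ρ) ρ) :=
    Force.eq_iff.2 (EqF.refl _)
  have h' := h.congr_val (ρ' := Fin.cons (ap f ρ) ρ')
    (fun i => Fin.cases (EqF.refl _) (fun j => he j) i)
  exact Force.eq_iff.1 h'

theorem EqF.succ (h : EqF T w a b) : EqF T w (succE a) (succE b) :=
  EqF.ap_congr _ fun _ => h

theorem EqF.ap_pair_congr {a' b' : Elt} (f : PrimRecSymb 2) (h : EqF T w a a')
    (h' : EqF T w b b') : EqF T w (ap f (pair a b)) (ap f (pair a' b')) :=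
  EqF.ap_congr f fun i => match i with
    | 0 => h
    | 1 => h'

end Equality

/-- `T` contains Heyting arithmetic. -/
class ExtendsHA (T : Set Sentence) : Prop where
  subset : HA ⊆ T

section Axioms

variable {T : Set Sentence} [hT : ExtendsHA T] {w w' : World} {n m : ℕ} {a b c : Elt}

theorem Force.haAxiom {φ : Formula n} (h : HAAxiom φ) (ρ : Fin n → Elt) : Force T w φ ρ :=
  Force.axiom_close (hT.subset ⟨n, φ, h, rfl⟩) ρ

theorem EqF.succ_ne_zero (h : EqF T w (succE a) zeroE) : Force T w .bot Fin.elim0 := by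
  refine Force.neg_elim (Force.haAxiom .succ_ne_zero (Fin.cons a Fin.elim0)) ?_
  simpa using h

theorem EqF.proj (i : Fin n) (ρ : Fin n → Elt) : EqF T w (ap (.proj i) ρ) (ρ i) :=
  Force.eq_iff.1 (Force.haAxiom (.proj i) ρ)

theorem EqF.comp (f : PrimRecSymb m) (g : Fin m → PrimRecSymb n) (ρ : Fin n → Elt) :
    EqF T w (ap (.comp f g) ρ) (ap f fun j => ap (g j) ρ) :=
  Force.eq_iff.1 (Force.haAxiom (.comp f g) ρ)

theorem EqF.prec_zero (f : PrimRecSymb n) (g : PrimRecSymb (n + 2)) (ρ : Fin n → Elt) :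
    EqF T w (ap (.prec f g) (Fin.cons zeroE ρ)) (ap f ρ) := by
  have h := Force.eq_iff.1 (Force.haAxiom (T := T) (w := w) (.prec_zero f g) ρ)
  rw [app_subst, app_subst] at h
  convert h using 2
  · funext i
    exact Fin.cases (by simp) (fun j => rfl) i
  · rfl

theorem EqF.prec_succ (f : PrimRecSymb n) (g : PrimRecSymb (n + 2)) (a : Elt) (ρ : Fin n → Elt) :
    EqF T w (ap (.prec f g) (Fin.cons (succE a) ρ))
      (ap g (Fin.cons a (Fin.cons (ap (.prec f g) (Fin.cons a ρ)) ρ))) := by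
  have h := Force.eq_iff.1 (Force.haAxiom (T := T) (w := w) (.prec_succ f g) (Fin.cons a ρ))
  rw [app_subst, app_subst] at h
  convert h using 2
  · funext i
    exact Fin.cases rfl (fun j => rfl) i
  · funext i
    exact Fin.cases rfl (fun j => Fin.cases rfl (fun j => rfl) j) i

theorem Force.induction {φ : Formula (n + 1)} {ρ : Fin n → Elt}
    (h0 : Force T w φ (Fin.cons zeroE ρ))
    (hs : ∀ w' a, w ⊆ w' → Force T w' φ (Fin.cons a ρ) → Force T w' φ (Fin.cons (succE a) ρ))
    (a : Elt) : Force T w φ (Fin.cons a ρ) := by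
  have h := Force.haAxiom (T := T) (w := w) (.induction φ) ρ
  refine Force.all_iff.1 (h.mp (Force.and_iff.2 ⟨?_, ?_⟩)) a
  · rw [Formula.inst, Force.subst_iff]
    convert h0 using 1
    funext i
    exact Fin.cases (by simp) (fun j => rfl) i
  · refine Force.all_iff.2 fun t => Force.imp_iff.2 fun w' hw h => ?_
    rw [Force.subst_iff]
    convert hs w' t hw h using 1
    funext i
    exact Fin.cases rfl (fun j => rfl) i

/-- Induction in which the induction hypothesis plays no role. The form with an arbitrary goal `χ`
hides the elimination of `∨` and `∃`. -/
theorem Force.zero_or_succ {χ : Formula m} {ρ : Fin m → Elt} (a : Elt)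
    (h0 : ∀ w', w ⊆ w' → EqF T w' a zeroE → Force T w' χ ρ)
    (hs : ∀ w' b, w ⊆ w' → EqF T w' a (succE b) → Force T w' χ ρ) : Force T w χ ρ := by
  have h : Force T w (.or (.eq (v 0) zeroTm) (.ex (.eq (v 1) (succTm (v 0)))))
      (Fin.cons a Fin.elim0) := by
    refine Force.induction (Force.orI₁ ?_) (fun w' b _ _ => Force.orI₂ (Force.exI b ?_)) a
    · simpa using EqF.refl _
    · simpa using EqF.refl _
  refine h.orE (fun w' hw h => h0 w' hw (by simpa using h)) fun w' hw h => ?_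
  exact h.exE fun w'' b hw' h => hs w'' b (List.Subset.trans hw hw') (by simpa using h)

theorem Force.cases {φ : Formula (n + 1)} {ρ : Fin n → Elt} (a : Elt)
    (h0 : Force T w φ (Fin.cons zeroE ρ))
    (hs : ∀ w' b, w ⊆ w' → Force T w' φ (Fin.cons (succE b) ρ)) : Force T w φ (Fin.cons a ρ) :=
  Force.zero_or_succ a (fun _ hw h => h.symm.leibniz (h0.mono hw))
    fun w' b hw h => h.symm.leibniz (hs w' b hw)

/-- Induction on `b` for the formula quantified universally over `a`, with a case distinction on `a`
at each stage. -/
theorem Force.double_induction {φ : Formula (n + 2)} {ρ : Fin n → Elt}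
    (h0 : ∀ w' b, w ⊆ w' → Force T w' φ (Fin.cons zeroE (Fin.cons b ρ)))
    (h1 : ∀ w' a, w ⊆ w' → Force T w' φ (Fin.cons (succE a) (Fin.cons zeroE ρ)))
    (hs : ∀ w' a b, w ⊆ w' → Force T w' φ (Fin.cons a (Fin.cons b ρ)) →
      Force T w' φ (Fin.cons (succE a) (Fin.cons (succE b) ρ)))
    (a b : Elt) : Force T w φ (Fin.cons a (Fin.cons b ρ)) := by
  refine Force.all_iff.1 (Force.induction (φ := .all φ) ?_ ?_ b) a
  · exact Force.all_iff.2 fun a => Force.cases a (h0 w _ (List.Subset.refl _)) h1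
  · intro w' b hw h
    refine Force.all_iff.2 fun a => Force.cases a (h0 w' _ hw) fun w'' a hw' => ?_
    exact hs w'' a b (List.Subset.trans hw hw') (Force.all_iff.1 (h.mono hw') a)

end Axioms

/-! ## Truncated subtraction and the order -/

/-- The constant zero function. -/
def zeroSymb {n : ℕ} : PrimRecSymb n := .comp .zero Fin.elim0

/-- The predecessor function. -/
def predSymb : PrimRecSymb 1 := .prec .zero (.proj 0)

/-- Truncated subtraction, with the subtrahend as the first argument. -/
def subSymb : PrimRecSymb 2 := .prec (.proj 0) (.comp predSymb fun _ => .proj 1)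

/-- The formula `s ≤ t`. -/
def Formula.le {n : ℕ} (s t : Tm n) : Formula n := .eq (app subSymb (pair t s)) zeroTm

/-- The formula `s < t`. -/
def Formula.lt {n : ℕ} (s t : Tm n) : Formula n := .le (succTm s) t

/-- `a ≤ b` is forced. -/
def LeF (T : Set Sentence) (w : World) (a b : Elt) : Prop := EqF T w (ap subSymb (pair b a)) zeroE

section Order

variable {T : Set Sentence} {w w' : World} {n m : ℕ} {a b c : Elt}

@[simp] theorem Force.le_iff {s t : Tm n} {ρ : Fin n → Elt} :
    Force T w (.le s t) ρ ↔ LeF T w (s.subst ρ) (t.subst ρ) := by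
  rw [Formula.le, Force.eq_iff, app_subst, pair_subst, zeroTm_subst, LeF]

@[simp] theorem Force.lt_iff {s t : Tm n} {ρ : Fin n → Elt} :
    Force T w (.lt s t) ρ ↔ LeF T w (succE (s.subst ρ)) (t.subst ρ) := by
  rw [Formula.lt, Force.le_iff, succTm_subst]

theorem LeF.mono (h : LeF T w a b) (hw : w ⊆ w') : LeF T w' a b := EqF.mono h hw

theorem LeF.congr {a' b' : Elt} (h : LeF T w a b) (ha : EqF T w a a') (hb : EqF T w b b') :
    LeF T w a' b' := (EqF.ap_pair_congr subSymb hb.symm ha.symm).trans h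

variable [hT : ExtendsHA T]

theorem EqF.zeroSymb (ρ : Fin n → Elt) : EqF T w (ap zeroSymb ρ) zeroE := by
  refine (EqF.comp _ _ _).trans ?_
  rw [zeroE, Subsingleton.elim (fun j => _) Fin.elim0]
  exact EqF.refl _

theorem EqF.pred_zero : EqF T w (ap predSymb fun _ => zeroE) zeroE := by
  have := EqF.prec_zero (T := T) (w := w) .zero (.proj 0) Fin.elim0
  rwa [show (Fin.cons zeroE Fin.elim0 : Fin 1 → Elt) = fun _ => zeroE by
    funext i; fin_cases i; rfl] at this

theorem EqF.pred_succ (a : Elt) : EqF T w (ap predSymb fun _ => succE a) a := by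
  have := EqF.prec_succ (T := T) (w := w) .zero (.proj 0) a Fin.elim0
  rw [show (Fin.cons (succE a) Fin.elim0 : Fin 1 → Elt) = fun _ => succE a by
    funext i; fin_cases i; rfl] at this
  exact this.trans (EqF.proj _ _)

theorem EqF.sub_zero (a : Elt) : EqF T w (ap subSymb (pair zeroE a)) a :=
  (EqF.prec_zero _ _ _).trans (EqF.proj _ _)

theorem EqF.sub_succ (a b : Elt) : EqF T w (ap subSymb (pair (succE b) a))
    (ap predSymb fun _ => ap subSymb (pair b a)) :=
  (EqF.prec_succ _ _ _ _).trans ((EqF.comp _ _ _).trans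
    (EqF.ap_congr _ fun _ => EqF.proj _ _))

theorem EqF.sub_succ_succ (a b : Elt) :
    EqF T w (ap subSymb (pair (succE b) (succE a))) (ap subSymb (pair b a)) := by
  have h : Force T w (.eq (app subSymb (pair (succTm (v 0)) (succTm (v 1))))
      (app subSymb (pair (v 0) (v 1)))) (Fin.cons b (Fin.cons a Fin.elim0)) := by
    refine Force.induction ?_ ?_ b
    · simp only [Force.eq_iff, app_subst, pair_subst, succTm_subst, v_subst, Fin.cons_zero,
        Fin.cons_one]
      refine (EqF.sub_succ _ _).trans (.trans ?_ (EqF.sub_zero _).symm)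
      exact (EqF.ap_congr _ fun _ => EqF.sub_zero _).trans (EqF.pred_succ _)
    · intro w' b hw h
      simp only [Force.eq_iff, app_subst, pair_subst, succTm_subst, v_subst, Fin.cons_zero,
        Fin.cons_one] at h ⊢
      refine (EqF.sub_succ _ _).trans (.trans ?_ (EqF.sub_succ _ _).symm)
      exact EqF.ap_congr _ fun _ => h
  simpa only [Force.eq_iff, app_subst, pair_subst, succTm_subst, v_subst, Fin.cons_zero,
        Fin.cons_one] using h

theorem LeF.succ_iff : LeF T w (succE a) (succE b) ↔ LeF T w a b :=
  ⟨fun h => (EqF.sub_succ_succ a b).symm.trans h, fun h => (EqF.sub_succ_succ a b).trans h⟩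

theorem LeF.zero (b : Elt) : LeF T w zeroE b := by
  have h : Force T w (.le zeroTm (v 0)) (Fin.cons b Fin.elim0) := by
    refine Force.induction ?_ ?_ b
    · simpa [LeF] using EqF.sub_zero (T := T) (w := w) zeroE
    · intro w' b hw h
      simp only [Force.le_iff, zeroTm_subst, v_subst, Fin.cons_zero] at h ⊢
      exact (EqF.sub_succ _ _).trans ((EqF.ap_congr _ fun _ => h).trans EqF.pred_zero)
  simpa using h

theorem LeF.succ_zero (h : LeF T w (succE a) zeroE) : Force T w .bot Fin.elim0 :=
  EqF.succ_ne_zero ((EqF.sub_zero _).symm.trans h)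

theorem LeF.refl (a : Elt) : LeF T w a a := by
  have h : Force T w (.le (v 0) (v 0)) (Fin.cons a Fin.elim0) := by
    refine Force.induction ?_ ?_ a
    · simpa using LeF.zero _
    · intro w' b hw h
      simpa [LeF.succ_iff] using h
  simpa using h

theorem EqF.le (h : EqF T w a b) : LeF T w a b := (LeF.refl a).congr (EqF.refl a) h

theorem LeF.succ_self (a : Elt) : LeF T w a (succE a) := by
  have h : Force T w (.le (v 0) (succTm (v 0))) (Fin.cons a Fin.elim0) := by
    refine Force.induction ?_ ?_ a
    · simpa using LeF.zero _
    · intro w' b hw h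
      simpa [LeF.succ_iff] using h
  simpa using h

theorem LeF.trans (h : LeF T w a b) (h' : LeF T w b c) : LeF T w a c := by
  -- The upper element `c` stays quantified, because the successor step needs the hypothesis at the
  -- predecessor of `c`.
  have key : Force T w (.all (.imp (.le (v 1) (v 2)) (.imp (.le (v 2) (v 0)) (.le (v 1) (v 0)))))
      (Fin.cons a (Fin.cons b Fin.elim0)) := by
    refine Force.double_induction ?_ ?_ ?_ a b
    · refine fun w' b hw => Force.all_iff.2 fun c => Force.imp_iff.2 fun w1 h1 _ =>
        Force.imp_iff.2 fun w2 h2 _ => ?_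
      simpa using LeF.zero _
    · refine fun w' b hw => Force.all_iff.2 fun c => Force.imp_iff.2 fun w1 h1 h => ?_
      simp only [Force.le_iff, v_subst, Fin.cons_one, cons_at_two, Fin.cons_zero] at h
      exact h.succ_zero.botE
    · refine fun w' a b hw ih => Force.all_iff.2 fun c => Force.cases c ?_ fun w0 c h0 => ?_
      · refine Force.imp_iff.2 fun w1 h1 _ => Force.imp_iff.2 fun w2 h2 h => ?_
        simp only [Force.le_iff, v_subst, Fin.cons_one, cons_at_two, Fin.cons_zero] at h
        exact h.succ_zero.botE
      · have ih := (Force.all_iff.1 ih c).mono h0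
        simpa [Force.imp_iff, LeF.succ_iff] using ih
  have := Force.mp (Force.mp (Force.all_iff.1 key c) (by simpa using h)) (by simpa using h')
  simpa using this

theorem LeF.lt_or_eq {χ : Formula m} {ρ : Fin m → Elt} (h : LeF T w a b)
    (h1 : ∀ w', w ⊆ w' → LeF T w' (succE a) b → Force T w' χ ρ)
    (h2 : ∀ w', w ⊆ w' → EqF T w' a b → Force T w' χ ρ) : Force T w χ ρ := by
  have key : Force T w (.imp (.le (v 0) (v 1)) (.or (.lt (v 0) (v 1)) (.eq (v 0) (v 1))))
      (Fin.cons a (Fin.cons b Fin.elim0)) := by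
    refine Force.double_induction (fun w' b hw => ?_) (fun w' a hw => ?_)
      (fun w' a b hw ih => ?_) a b
    · refine Force.imp_iff.2 fun w1 hw1 _ => ?_
      refine Force.zero_or_succ (T := T) b (fun w2 _ h => Force.orI₂ ?_)
        (fun w2 c _ h => Force.orI₁ ?_)
      · simpa using h.symm
      · have := (LeF.succ_iff.2 (LeF.zero c)).congr (EqF.refl (T := T) (w := w2) _) h.symm
        simpa using this
    · refine Force.imp_iff.2 fun w1 hw1 h => ?_
      exact (LeF.succ_zero (by simpa using h)).botE
    · refine Force.imp_iff.2 fun w1 hw1 h => ?_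
      refine ((ih.mono hw1).mp (by simpa [LeF.succ_iff] using h)).orE (fun w2 hw2 h => ?_)
        (fun w2 hw2 h => ?_)
      · refine Force.orI₁ (by simpa [LeF.succ_iff] using h)
      · refine Force.orI₂ (by simpa using EqF.succ (by simpa using h))
  refine (Force.mp key (by simpa using h)).orE (fun w2 hw2 h => h1 _ hw2 (by simpa using h))
    (fun w2 hw2 h => h2 _ hw2 (by simpa using h))

theorem LeF.total {χ : Formula m} {ρ : Fin m → Elt} (a b : Elt)
    (h1 : ∀ w', w ⊆ w' → LeF T w' a b → Force T w' χ ρ)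
    (h2 : ∀ w', w ⊆ w' → LeF T w' (succE b) a → Force T w' χ ρ) : Force T w χ ρ := by
  have key : Force T w (.or (.le (v 0) (v 1)) (.lt (v 1) (v 0)))
      (Fin.cons a (Fin.cons b Fin.elim0)) := by
    refine Force.double_induction (fun w' b hw => Force.orI₁ ?_) (fun w' a hw => Force.orI₂ ?_)
      (fun w' a b hw ih => ih.orE (fun w2 hw2 h => Force.orI₁ ?_)
        (fun w2 hw2 h => Force.orI₂ ?_)) a b
    · simpa using LeF.zero _
    · simpa [LeF.succ_iff] using LeF.zero _
    · simpa [LeF.succ_iff] using h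
    · simpa [LeF.succ_iff] using h
  exact key.orE (fun w2 hw2 h => h1 _ hw2 (by simpa using h))
    (fun w2 hw2 h => h2 _ hw2 (by simpa using h))

theorem LeF.lt_irrefl (h : LeF T w (succE a) a) : Force T w .bot Fin.elim0 := by
  have key : Force T w (.neg (.lt (v 0) (v 0))) (Fin.cons a Fin.elim0) := by
    refine Force.induction ?_ ?_ a
    · exact Force.neg_iff.2 fun w1 h1 h => LeF.succ_zero (by simpa using h)
    · intro w' b hw h
      simpa [Force.neg_iff, LeF.succ_iff] using h
  exact key.neg_elim (by simpa using h)

theorem LeF.antisymm (h : LeF T w a b) (h' : LeF T w b a) : EqF T w a b := by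
  have : Force T w (.eq (v 0) (v 1)) (pair a b) :=
    h.lt_or_eq (fun w1 h1 hab => (LeF.lt_irrefl (hab.trans (h'.mono h1))).botE)
      fun w1 h1 hab => Force.eq_iff.2 hab
  exact this

/-- Two individuals have a common strict upper bound. -/
theorem LeF.exists_upper {χ : Formula m} {ρ : Fin m → Elt} (a b : Elt)
    (h : ∀ w' c, w ⊆ w' → LeF T w' (succE a) c → LeF T w' (succE b) c → Force T w' χ ρ) :
    Force T w χ ρ :=
  LeF.total a b
    (fun w' hw h' => h w' (succE b) hw (LeF.succ_iff.2 h') (LeF.refl _))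
    fun w' hw h' => h w' (succE a) hw (LeF.refl _)
      (LeF.succ_iff.2 ((LeF.succ_self _).trans h'))

end Order

/-! ## Bounded quantifiers -/

/-- The formula `φ` with its first variable kept and a further variable put after it. -/
def Formula.shiftTail {n : ℕ} (φ : Formula (n + 1)) : Formula (n + 2) :=
  φ.subst (Fin.cons (v 0) fun i => v i.succ.succ)

/-- `∀ y < x, φ y`, where `x` is the first variable of the result. -/
def Formula.ball {n : ℕ} (φ : Formula (n + 1)) : Formula (n + 1) :=
  .all (.imp (.lt (v 0) (v 1)) φ.shiftTail)

/-- `∃ y < x, φ y`, where `x` is the first variable of the result. -/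
def Formula.bex {n : ℕ} (φ : Formula (n + 1)) : Formula (n + 1) :=
  .ex (.and (.lt (v 0) (v 1)) φ.shiftTail)

section Bounded

variable {T : Set Sentence} {w w' : World} {n m : ℕ} {a b c : Elt} {ρ : Fin n → Elt}

@[simp] theorem Force.shiftTail_iff {φ : Formula (n + 1)} :
    Force T w φ.shiftTail (Fin.cons a (Fin.cons b ρ)) ↔ Force T w φ (Fin.cons a ρ) := by
  rw [Formula.shiftTail, Force.subst_iff]
  congr! 1
  funext i
  exact Fin.cases rfl (fun j => rfl) i

@[simp] theorem Force.shift_iff {φ : Formula n} :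
    Force T w φ.shift (Fin.cons a ρ) ↔ Force T w φ ρ := by
  rw [Formula.shift, Force.subst_iff]
  rfl

theorem Force.ball_iff {φ : Formula (n + 1)} : Force T w φ.ball (Fin.cons b ρ) ↔
    ∀ w' a, w ⊆ w' → LeF T w' (succE a) b → Force T w' φ (Fin.cons a ρ) := by
  simp only [Formula.ball, Force.all_iff, Force.imp_iff, Force.lt_iff, v_subst, Fin.cons_zero,
    Fin.cons_one, Force.shiftTail_iff]
  exact ⟨fun h w' a => h a w', fun h a w' => h w' a⟩

theorem Force.bexI {φ : Formula (n + 1)} (h : LeF T w (succE a) b)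
    (h' : Force T w φ (Fin.cons a ρ)) : Force T w φ.bex (Fin.cons b ρ) :=
  Force.exI a (Force.and_iff.2 ⟨by simpa using h, by simpa using h'⟩)

theorem Force.bexE {φ : Formula (n + 1)} {χ : Formula m} {ρ' : Fin m → Elt}
    (h : Force T w φ.bex (Fin.cons b ρ))
    (h' : ∀ w' a, w ⊆ w' → LeF T w' (succE a) b → Force T w' φ (Fin.cons a ρ) →
      Force T w' χ ρ') : Force T w χ ρ' :=
  h.exE fun w' a hw h => h' w' a hw (by simpa using (Force.and_iff.1 h).1)
    (by simpa using (Force.and_iff.1 h).2)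

variable [hT : ExtendsHA T]

theorem Force.ball_zero {φ : Formula (n + 1)} : Force T w φ.ball (Fin.cons zeroE ρ) :=
  Force.ball_iff.2 fun _ _ _ h => h.succ_zero.botE

theorem Force.ball_succ_iff {φ : Formula (n + 1)} : Force T w φ.ball (Fin.cons (succE b) ρ) ↔
    Force T w φ.ball (Fin.cons b ρ) ∧ Force T w φ (Fin.cons b ρ) := by
  simp only [Force.ball_iff]
  refine ⟨fun h => ⟨fun w' a hw h' => h w' a hw (h'.trans (LeF.succ_self b)),
    h w b (List.Subset.refl _) (LeF.refl _)⟩, fun h w' a hw h' => ?_⟩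
  refine (LeF.succ_iff.1 h').lt_or_eq (fun w1 hw1 h' => ?_) (fun w1 hw1 h' => ?_)
  · exact h.1 _ _ (List.Subset.trans hw hw1) h'
  · exact h'.symm.leibniz (h.2.mono (List.Subset.trans hw hw1))

end Bounded

/-! ## Characteristic functions of quantifier-free formulas -/

/-- A function of two arguments that vanishes iff both arguments do. -/
def andSymb : PrimRecSymb 2 := .prec (.proj 0) (.comp .succ fun _ => .proj 0)

/-- A function of two arguments that vanishes iff one of the arguments does. -/
def orSymb : PrimRecSymb 2 := .prec zeroSymb (.proj 2)

/-- A function of two arguments that vanishes iff the second argument vanishes or the first one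
does not. -/
def impSymb : PrimRecSymb 2 := .prec (.proj 0) zeroSymb

/-- The function symbol `f` vanishes exactly where `φ` holds. -/
def Represents (T : Set Sentence) {n : ℕ} (f : PrimRecSymb n) (φ : Formula n) : Prop :=
  ∀ w ρ, Force T w φ ρ ↔ EqF T w (ap f ρ) zeroE

section Characteristic

variable {T : Set Sentence} [hT : ExtendsHA T] {w w' : World} {n m : ℕ} {a b c : Elt}
  {ρ : Fin n → Elt}

theorem EqF.zero_or_succ {a' b' : Elt} (a : Elt)
    (h0 : ∀ w', w ⊆ w' → EqF T w' a zeroE → EqF T w' a' b')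
    (hs : ∀ w' b, w ⊆ w' → EqF T w' a (succE b) → EqF T w' a' b') : EqF T w a' b' :=
  Force.zero_or_succ (χ := .eq (v 0) (v 1)) a h0 hs

theorem EqF.prec_pair_zero (f : PrimRecSymb 1) (g : PrimRecSymb 3) (h : EqF T w a zeroE) :
    EqF T w (ap (.prec f g) (pair a b)) (ap f (Fin.cons b Fin.elim0)) :=
  (EqF.ap_pair_congr _ h (EqF.refl b)).trans (EqF.prec_zero _ _ _)

theorem EqF.prec_pair_succ (f : PrimRecSymb 1) (g : PrimRecSymb 3) (h : EqF T w a (succE c)) :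
    EqF T w (ap (.prec f g) (pair a b))
      (ap g (Fin.cons c (Fin.cons (ap (.prec f g) (pair c b)) (Fin.cons b Fin.elim0)))) :=
  (EqF.ap_pair_congr _ h (EqF.refl b)).trans (EqF.prec_succ _ _ _ _)

theorem EqF.and_of_zero (h : EqF T w a zeroE) : EqF T w (ap andSymb (pair a b)) b :=
  (EqF.prec_pair_zero _ _ h).trans (EqF.proj _ _)

theorem EqF.and_of_succ (h : EqF T w a (succE c)) :
    EqF T w (ap andSymb (pair a b)) (succE c) :=
  (EqF.prec_pair_succ _ _ h).trans ((EqF.comp _ _ _).trans (EqF.proj (n := 3) 0 _).succ)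

theorem EqF.or_of_zero (h : EqF T w a zeroE) : EqF T w (ap orSymb (pair a b)) zeroE :=
  (EqF.prec_pair_zero _ _ h).trans (EqF.zeroSymb _)

theorem EqF.or_of_succ (h : EqF T w a (succE c)) : EqF T w (ap orSymb (pair a b)) b :=
  (EqF.prec_pair_succ _ _ h).trans (EqF.proj _ _)

theorem EqF.imp_of_zero (h : EqF T w a zeroE) : EqF T w (ap impSymb (pair a b)) b :=
  (EqF.prec_pair_zero _ _ h).trans (EqF.proj _ _)

theorem EqF.imp_of_succ (h : EqF T w a (succE c)) : EqF T w (ap impSymb (pair a b)) zeroE :=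
  (EqF.prec_pair_succ _ _ h).trans (EqF.zeroSymb _)

theorem EqF.and_iff :
    EqF T w (ap andSymb (pair a b)) zeroE ↔ EqF T w a zeroE ∧ EqF T w b zeroE := by
  refine ⟨fun h => ?_, fun h => (EqF.and_of_zero h.1).trans h.2⟩
  have ha : EqF T w a zeroE := EqF.zero_or_succ a (fun _ _ h => h) fun w' c hw h' =>
    EqF.botE (((EqF.and_of_succ h').symm.trans (h.mono hw)).succ_ne_zero)
  exact ⟨ha, (EqF.and_of_zero ha).symm.trans h⟩

theorem ap_comp_pair (h : PrimRecSymb 2) (f g : PrimRecSymb n) (ρ : Fin n → Elt) :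
    EqF T w (ap (.comp h (Fin.cons f (Fin.cons g Fin.elim0))) ρ)
      (ap h (pair (ap f ρ) (ap g ρ))) :=
  ap_pair f g ρ ▸ EqF.comp _ _ _

namespace Represents

variable {f g : PrimRecSymb n} {φ ψ : Formula n}

theorem and (hf : Represents T f φ) (hg : Represents T g ψ) :
    Represents T (.comp andSymb (Fin.cons f (Fin.cons g Fin.elim0))) (.and φ ψ) := by
  intro w ρ
  rw [(ap_comp_pair _ f g ρ).zero_congr, EqF.and_iff, Force.and_iff, hf, hg]

theorem or (hf : Represents T f φ) (hg : Represents T g ψ) :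
    Represents T (.comp orSymb (Fin.cons f (Fin.cons g Fin.elim0))) (.or φ ψ) := by
  intro w ρ
  rw [(ap_comp_pair _ f g ρ).zero_congr]
  refine ⟨fun h => ?_, fun h => ?_⟩
  · refine EqF.zero_or_succ (ap f ρ) (fun _ _ h => EqF.or_of_zero h) fun w1 c hw h1 => ?_
    refine (EqF.or_of_succ h1).trans ((hg _ _).1 ?_)
    refine (h.mono hw).orE (fun w2 hw2 h2 => ?_) fun w2 _ h2 => h2
    -- Here `φ` holds, so `f` vanishes, although its value is a successor.
    exact (((h1.mono hw2).symm.trans ((hf _ _).1 h2)).succ_ne_zero).botE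
  · refine Force.zero_or_succ (T := T) (ap f ρ) (fun _ _ h => Force.orI₁ ((hf _ _).2 h))
      fun w1 c hw h1 => Force.orI₂ ((hg _ _).2 ?_)
    exact (EqF.or_of_succ h1).symm.trans (h.mono hw)

theorem imp (hf : Represents T f φ) (hg : Represents T g ψ) :
    Represents T (.comp impSymb (Fin.cons f (Fin.cons g Fin.elim0))) (.imp φ ψ) := by
  intro w ρ
  rw [(ap_comp_pair _ f g ρ).zero_congr, Force.imp_iff]
  refine ⟨fun h => ?_, fun h w' hw h' => ?_⟩
  · refine EqF.zero_or_succ (ap f ρ) (fun w1 hw h1 => ?_) fun w1 c hw h1 => EqF.imp_of_succ h1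
    exact (EqF.imp_of_zero h1).trans ((hg _ _).1 (h w1 hw ((hf _ _).2 h1)))
  · exact (hg _ _).2 ((EqF.imp_of_zero ((hf _ _).1 h')).symm.trans (h.mono hw))

theorem bot : Represents T (.comp .succ fun _ => zeroSymb) (.bot : Formula n) := by
  intro w ρ
  refine ⟨Force.botE, fun h => ?_⟩
  exact (((EqF.comp _ _ _).symm.trans h).succ_ne_zero).botE

end Represents

theorem exists_term_symb (t : Tm n) :
    ∃ f : PrimRecSymb n, ∀ w ρ, EqF T w (ap f ρ) (t.subst ρ) := by
  induction t with
  | var i => exact ⟨.proj i, fun w ρ => EqF.proj i ρ⟩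
  | func g ts ih =>
    choose f hf using ih
    exact ⟨.comp g f, fun w ρ => (EqF.comp _ _ _).trans (EqF.ap_congr g fun i => hf i w ρ)⟩

/-- By antisymmetry, `s = t` holds iff both truncated differences vanish. -/
theorem exists_represents_eq (s t : Tm n) : ∃ f, Represents T f (.eq s t) := by
  obtain ⟨f, hf⟩ := exists_term_symb (T := T) s
  obtain ⟨g, hg⟩ := exists_term_symb (T := T) t
  have hs : ∀ (f g : PrimRecSymb n) w ρ,
      EqF T w (ap (.comp subSymb (Fin.cons g (Fin.cons f Fin.elim0))) ρ) zeroE ↔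
        LeF T w (ap f ρ) (ap g ρ) := fun f g w ρ => (ap_comp_pair _ g f ρ).zero_congr
  refine ⟨.comp andSymb (Fin.cons (.comp subSymb (Fin.cons g (Fin.cons f Fin.elim0)))
    (Fin.cons (.comp subSymb (Fin.cons f (Fin.cons g Fin.elim0))) Fin.elim0)), fun w ρ => ?_⟩
  rw [(ap_comp_pair _ _ _ ρ).zero_congr, EqF.and_iff, hs, hs, Force.eq_iff]
  refine ⟨fun h => ?_, fun h => ?_⟩
  · have := ((hf w ρ).trans h).trans (hg w ρ).symm
    exact ⟨this.le, this.symm.le⟩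
  · exact ((hf w ρ).symm.trans (h.1.antisymm h.2)).trans (hg w ρ)

/-- Replacing a quantifier-free formula by an equation `f = 0` lets a bounded quantifier be absorbed
into the function symbol. -/
theorem Formula.IsQF.exists_represents {φ : Formula n} (h : φ.IsQF) : ∃ f, Represents T f φ := by
  induction φ with
  | bot => exact ⟨_, .bot⟩
  | eq s t => exact exists_represents_eq s t
  | and φ ψ ih1 ih2 =>
    obtain ⟨f, hf⟩ := ih1 h.1
    obtain ⟨g, hg⟩ := ih2 h.2
    exact ⟨_, hf.and hg⟩
  | or φ ψ ih1 ih2 =>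
    obtain ⟨f, hf⟩ := ih1 h.1
    obtain ⟨g, hg⟩ := ih2 h.2
    exact ⟨_, hf.or hg⟩
  | imp φ ψ ih1 ih2 =>
    obtain ⟨f, hf⟩ := ih1 h.1
    obtain ⟨g, hg⟩ := ih2 h.2
    exact ⟨_, hf.imp hg⟩
  | all φ _ => exact h.elim
  | ex φ _ => exact h.elim

/-- A symbol for the characteristic function of a bounded universal quantification. -/
def ballSymb (f : PrimRecSymb (n + 1)) : PrimRecSymb (n + 1) :=
  .prec zeroSymb (.comp andSymb (Fin.cons (.proj 1) (Fin.cons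
    (.comp f (Fin.cons (.proj 0) fun i => .proj i.succ.succ)) Fin.elim0)))

theorem EqF.ballSymb_zero (f : PrimRecSymb (n + 1)) :
    EqF T w (ap (ballSymb f) (Fin.cons zeroE ρ)) zeroE :=
  (EqF.prec_zero _ _ _).trans (EqF.zeroSymb _)

theorem EqF.ballSymb_succ_iff (f : PrimRecSymb (n + 1)) :
    EqF T w (ap (ballSymb f) (Fin.cons (succE b) ρ)) zeroE ↔
      EqF T w (ap (ballSymb f) (Fin.cons b ρ)) zeroE ∧ EqF T w (ap f (Fin.cons b ρ)) zeroE := by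
  -- In the recursion step, argument `0` is the counter, argument `1` the previous value, and the
  -- parameters follow.
  rw [ballSymb, (EqF.prec_succ _ _ _ _).zero_congr, (ap_comp_pair _ _ _ _).zero_congr,
    EqF.and_iff, (EqF.proj 1 _).zero_congr, (EqF.comp f _ _).zero_congr]
  refine and_congr Iff.rfl (EqF.zero_congr (EqF.ap_congr f fun i => ?_))
  exact Fin.cases (EqF.proj (n := n + 2) 0 _) (fun j => EqF.proj (n := n + 2) j.succ.succ _) i

theorem Represents.ball {f : PrimRecSymb (n + 1)} {φ : Formula (n + 1)}
    (hf : Represents T f φ) : Represents T (ballSymb f) φ.ball := by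
  have hg : ∀ w ρ, Force T w (.eq (app (ballSymb f) v) zeroTm) ρ ↔
      EqF T w (ap (ballSymb f) ρ) zeroE := by
    intro w ρ
    rw [Force.eq_iff, app_subst, zeroTm_subst]
    rfl
  intro w ρ
  rw [← hg, ← Fin.cons_self_tail ρ]
  -- Induction needs an object formula, so the equivalence is put as a conjunction of two
  -- implications.
  have key : Force T w (.and (.imp φ.ball (.eq (app (ballSymb f) v) zeroTm))
      (.imp (.eq (app (ballSymb f) v) zeroTm) φ.ball)) (Fin.cons (ρ 0) (Fin.tail ρ)) := by
    refine Force.induction ?_ (fun w' b _ ih => ?_) (ρ 0)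
    · refine Force.and_iff.2 ⟨Force.imp_iff.2 fun w' _ _ => ?_,
        Force.imp_iff.2 fun w' _ _ => Force.ball_zero⟩
      exact (hg _ _).2 (EqF.ballSymb_zero f)
    · obtain ⟨ih1, ih2⟩ := Force.and_iff.1 ih
      refine Force.and_iff.2 ⟨Force.imp_iff.2 fun w' hw h => ?_,
        Force.imp_iff.2 fun w' hw h => ?_⟩
      · rw [Force.ball_succ_iff] at h
        rw [hg, EqF.ballSymb_succ_iff, ← hg, ← hf]
        exact ⟨(ih1.mono hw).mp h.1, h.2⟩
      · rw [hg, EqF.ballSymb_succ_iff, ← hg, ← hf] at h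
        rw [Force.ball_succ_iff]
        exact ⟨(ih2.mono hw).mp h.1, h.2⟩
  obtain ⟨h1, h2⟩ := Force.and_iff.1 key
  exact ⟨h1.mp, h2.mp⟩

end Characteristic

/-! ## The arithmetical hierarchy up to equivalence -/

/-- Equivalence of formulas over the theory `T`. -/
def Equivalent (T : Set Sentence) {n : ℕ} (φ ψ : Formula n) : Prop :=
  ∀ w ρ, Force T w φ ρ ↔ Force T w ψ ρ

namespace Equivalent

variable {T : Set Sentence} {n m : ℕ} {φ ψ χ φ' ψ' : Formula n}

theorem refl (φ : Formula n) : Equivalent T φ φ := fun _ _ => Iff.rfl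

theorem symm (h : Equivalent T φ ψ) : Equivalent T ψ φ := fun w ρ => (h w ρ).symm

theorem trans (h : Equivalent T φ ψ) (h' : Equivalent T ψ χ) : Equivalent T φ χ :=
  fun w ρ => (h w ρ).trans (h' w ρ)

theorem and (h : Equivalent T φ φ') (h' : Equivalent T ψ ψ') :
    Equivalent T (.and φ ψ) (.and φ' ψ') := fun w ρ => by
  rw [Force.and_iff, Force.and_iff, h, h']

theorem neg (h : Equivalent T φ φ') : Equivalent T (.neg φ) (.neg φ') := fun w ρ => by
  simp only [Force.neg_iff, h _ _]

theorem subst (h : Equivalent T φ φ') (τ : Fin n → Tm m) :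
    Equivalent T (φ.subst τ) (φ'.subst τ) := fun w ρ => by
  rw [Force.subst_iff, Force.subst_iff, h]

theorem all {φ φ' : Formula (n + 1)} (h : Equivalent T φ φ') :
    Equivalent T (.all φ) (.all φ') := fun w ρ => by
  simp only [Force.all_iff, h _ _]

theorem ex {φ φ' : Formula (n + 1)} (h : Equivalent T φ φ') :
    Equivalent T (.ex φ) (.ex φ') := fun _ _ =>
  ⟨fun h' => h'.exE fun _ t _ h' => .exI t ((h _ _).1 h'),
    fun h' => h'.exE fun _ t _ h' => .exI t ((h _ _).2 h')⟩

theorem ball {φ φ' : Formula (n + 1)} (h : Equivalent T φ φ') :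
    Equivalent T φ.ball φ'.ball := fun w ρ => by
  rw [← Fin.cons_self_tail ρ]
  simp only [Force.ball_iff, h _ _]

theorem exs {m : ℕ} {φ φ' : Formula (n + m)} (h : Equivalent T φ φ') :
    Equivalent T (exs m φ) (exs m φ') := by
  induction m with
  | zero => exact h
  | succ m ih => exact ih h.ex

theorem alls {m : ℕ} {φ φ' : Formula (n + m)} (h : Equivalent T φ φ') :
    Equivalent T (alls m φ) (alls m φ') := by
  induction m with
  | zero => exact h
  | succ m ih => exact ih h.all

theorem ex_shift (φ : Formula n) : Equivalent T φ (.ex φ.shift) := fun _ _ =>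
  ⟨fun h => .exI zeroE (Force.shift_iff.2 h), fun h => h.exE fun _ _ _ h => Force.shift_iff.1 h⟩

theorem all_shift (φ : Formula n) : Equivalent T φ (.all φ.shift) := fun _ _ =>
  ⟨fun h => Force.all_iff.2 fun _ => Force.shift_iff.2 h,
    fun h => Force.shift_iff.1 (Force.all_iff.1 h zeroE)⟩

theorem ex_and {φ : Formula (n + 1)} :
    Equivalent T (.ex (.and φ ψ.shift)) (.and (.ex φ) ψ) := by
  refine fun w ρ => ⟨fun h => h.exE fun w' t _ h => ?_, fun h => ?_⟩
  · rw [Force.and_iff, Force.shift_iff] at h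
    exact Force.and_iff.2 ⟨.exI t h.1, h.2⟩
  · rw [Force.and_iff] at h
    exact h.1.exE fun w' t hw h' =>
      .exI t (Force.and_iff.2 ⟨h', Force.shift_iff.2 (h.2.mono hw)⟩)

theorem all_and {φ : Formula (n + 1)} :
    Equivalent T (.all (.and φ ψ.shift)) (.and (.all φ) ψ) := by
  intro w ρ
  simp only [Force.all_iff, Force.and_iff, Force.shift_iff, forall_and, forall_const]

theorem and_comm : Equivalent T (.and φ ψ) (.and ψ φ) := fun w ρ => by
  rw [Force.and_iff, Force.and_iff, _root_.and_comm]

theorem deMorgan {φ φ' ψ ψ' : Formula n} (e : Equivalent T φ φ')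
    (e' : Equivalent T ψ ψ') :
    Equivalent T (.imp (.neg (.and φ ψ)) (.or (.neg φ) (.neg ψ)))
      (.imp (.neg (.and φ' ψ')) (.or (.neg φ') (.neg ψ'))) := by
  have key : ∀ {φ φ' ψ ψ' : Formula n}, Equivalent T φ φ' → Equivalent T ψ ψ' → ∀ w ρ,
      Force T w (.imp (.neg (.and φ ψ)) (.or (.neg φ) (.neg ψ))) ρ →
      Force T w (.imp (.neg (.and φ' ψ')) (.or (.neg φ') (.neg ψ'))) ρ := by
    intro φ φ' ψ ψ' e e' w ρ h
    refine Force.imp_iff.2 fun w1 hw h' => ?_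
    exact ((h.mono hw).mp (((e.and e').neg _ _).2 h')).orE
      (fun _ _ h => Force.orI₁ ((e.neg _ _).1 h)) (fun _ _ h => Force.orI₂ ((e'.neg _ _).1 h))
  exact fun w ρ => ⟨key e e' w ρ, key e.symm e'.symm w ρ⟩

end Equivalent

/-- The closure of a set of formulas under existential quantification and equivalence. -/
inductive ExCl (T : Set Sentence) (K : FormulaSet) : {n : ℕ} → Formula n → Prop
  | base {n : ℕ} {φ : Formula n} : φ ∈ K n → ExCl T K φ
  | ex {n : ℕ} {φ : Formula (n + 1)} : ExCl T K φ → ExCl T K (.ex φ)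
  | congr {n : ℕ} {φ ψ : Formula n} : Equivalent T φ ψ → ExCl T K φ → ExCl T K ψ

/-- The closure of a set of formulas under universal quantification and equivalence. -/
inductive AllCl (T : Set Sentence) (K : FormulaSet) : {n : ℕ} → Formula n → Prop
  | base {n : ℕ} {φ : Formula n} : φ ∈ K n → AllCl T K φ
  | all {n : ℕ} {φ : Formula (n + 1)} : AllCl T K φ → AllCl T K (.all φ)
  | congr {n : ℕ} {φ ψ : Formula n} : Equivalent T φ ψ → AllCl T K φ → AllCl T K ψ

mutual
/-- The formulas equivalent to a `Σⱼ` formula. -/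
def SigmaCl (T : Set Sentence) : ℕ → FormulaSet
  | 0 => fun _ => {φ | ∃ ψ, ψ.IsQF ∧ Equivalent T ψ φ}
  | j + 1 => fun _ => {φ | ExCl T (PiCl T j) φ}
/-- The formulas equivalent to a `Πⱼ` formula. -/
def PiCl (T : Set Sentence) : ℕ → FormulaSet
  | 0 => fun _ => {φ | ∃ ψ, ψ.IsQF ∧ Equivalent T ψ φ}
  | j + 1 => fun _ => {φ | AllCl T (SigmaCl T j) φ}
end

section Hierarchy

variable {T : Set Sentence} {n m : ℕ} {K K' : FormulaSet} {φ ψ : Formula n}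

theorem ExCl.mono (hK : ∀ n, K n ⊆ K' n) (h : ExCl T K φ) : ExCl T K' φ := by
  induction h with
  | base h => exact .base (hK _ h)
  | ex _ ih => exact .ex ih
  | congr e _ ih => exact .congr e ih

theorem AllCl.mono (hK : ∀ n, K n ⊆ K' n) (h : AllCl T K φ) : AllCl T K' φ := by
  induction h with
  | base h => exact .base (hK _ h)
  | all _ ih => exact .all ih
  | congr e _ ih => exact .congr e ih

/-- A set of formulas is closed under substitution. -/
def SubstClosed (K : FormulaSet) : Prop :=
  ∀ (n m : ℕ) (φ : Formula n) (τ : Fin n → Tm m), φ ∈ K n → φ.subst τ ∈ K m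

/-- A set of formulas is closed under conjunction. -/
def AndClosed (K : FormulaSet) : Prop :=
  ∀ (n : ℕ) (φ ψ : Formula n), φ ∈ K n → ψ ∈ K n → .and φ ψ ∈ K n

/-- A set of formulas is closed under bounded universal quantification. -/
def BallClosed (K : FormulaSet) : Prop :=
  ∀ (n : ℕ) (φ : Formula (n + 1)), φ ∈ K (n + 1) → φ.ball ∈ K (n + 1)

/-- A set of formulas is closed under bounded existential quantification. -/
def BexClosed (K : FormulaSet) : Prop :=
  ∀ (n : ℕ) (φ : Formula (n + 1)), φ ∈ K (n + 1) → φ.bex ∈ K (n + 1)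

theorem ExCl.subst (hK : SubstClosed K) (h : ExCl T K φ) :
    ∀ {m : ℕ} (τ : Fin n → Tm m), ExCl T K (φ.subst τ) := by
  induction h with
  | base h => exact fun τ => .base (hK _ _ _ τ h)
  | ex _ ih => exact fun τ => .ex (ih _)
  | congr e _ ih => exact fun τ => .congr (e.subst τ) (ih τ)

theorem AllCl.subst (hK : SubstClosed K) (h : AllCl T K φ) :
    ∀ {m : ℕ} (τ : Fin n → Tm m), AllCl T K (φ.subst τ) := by
  induction h with
  | base h => exact fun τ => .base (hK _ _ _ τ h)
  | all _ ih => exact fun τ => .all (ih _)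
  | congr e _ ih => exact fun τ => .congr (e.subst τ) (ih τ)

/-- Quantifiers are pulled out of one conjunct, then, in the base case, out of the other; the
conjunct left behind is shifted, hence the need for closure under substitution. -/
theorem ExCl.and (hs : SubstClosed K) (ha : AndClosed K) (h : ExCl T K φ) :
    ∀ {ψ : Formula n}, ExCl T K ψ → ExCl T K (.and φ ψ) := by
  induction h with
  | base h =>
    intro ψ h'
    induction h' with
    | base h' => exact .base (ha _ _ _ h h')
    | ex _ ih =>
      exact .congr (.trans .ex_and .and_comm) (.ex (.congr .and_comm (ih (hs _ _ _ _ h))))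
    | congr e _ ih => exact .congr (.and (.refl _) e) (ih h)
  | ex _ ih => exact fun h' => .congr .ex_and (.ex (ih (h'.subst hs _)))
  | congr e _ ih => exact fun h' => .congr (.and e (.refl _)) (ih h')

theorem AllCl.and (hs : SubstClosed K) (ha : AndClosed K) (h : AllCl T K φ) :
    ∀ {ψ : Formula n}, AllCl T K ψ → AllCl T K (.and φ ψ) := by
  induction h with
  | base h =>
    intro ψ h'
    induction h' with
    | base h' => exact .base (ha _ _ _ h h')
    | all _ ih =>
      exact .congr (.trans .all_and .and_comm) (.all (.congr .and_comm (ih (hs _ _ _ _ h))))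
    | congr e _ ih => exact .congr (.and (.refl _) e) (ih h)
  | all _ ih => exact fun h' => .congr .all_and (.all (ih (h'.subst hs _)))
  | congr e _ ih => exact fun h' => .congr (.and e (.refl _)) (ih h')

theorem sigmaCl_succ {j : ℕ} : φ ∈ SigmaCl T (j + 1) n ↔ ExCl T (PiCl T j) φ := by
  simp only [SigmaCl, Set.mem_ofPred_eq]

theorem piCl_succ {j : ℕ} : φ ∈ PiCl T (j + 1) n ↔ AllCl T (SigmaCl T j) φ := by
  simp only [PiCl, Set.mem_ofPred_eq]

theorem sigmaCl_zero : φ ∈ SigmaCl T 0 n ↔ ∃ ψ, ψ.IsQF ∧ Equivalent T ψ φ := by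
  simp only [SigmaCl, Set.mem_ofPred_eq]

theorem piCl_zero : PiCl T 0 = SigmaCl T 0 := by
  funext n
  simp only [SigmaCl, PiCl]

theorem sigmaCl_congr {j : ℕ} (e : Equivalent T φ ψ) (h : φ ∈ SigmaCl T j n) :
    ψ ∈ SigmaCl T j n := by
  cases j with
  | zero =>
    obtain ⟨χ, h, h'⟩ := sigmaCl_zero.1 h
    exact sigmaCl_zero.2 ⟨χ, h, h'.trans e⟩
  | succ j => exact sigmaCl_succ.2 (.congr e (sigmaCl_succ.1 h))

theorem piCl_congr {j : ℕ} (e : Equivalent T φ ψ) (h : φ ∈ PiCl T j n) : ψ ∈ PiCl T j n := by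
  cases j with
  | zero => rw [piCl_zero] at h ⊢; exact sigmaCl_congr e h
  | succ j => exact piCl_succ.2 (.congr e (piCl_succ.1 h))

theorem Formula.IsQF.subst (h : φ.IsQF) (τ : Fin n → Tm m) : (φ.subst τ).IsQF := by
  induction φ generalizing m with
  | bot => trivial
  | eq s t => trivial
  | and φ ψ ih1 ih2 => exact ⟨ih1 h.1 τ, ih2 h.2 τ⟩
  | or φ ψ ih1 ih2 => exact ⟨ih1 h.1 τ, ih2 h.2 τ⟩
  | imp φ ψ ih1 ih2 => exact ⟨ih1 h.1 τ, ih2 h.2 τ⟩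
  | all φ _ => exact h.elim
  | ex φ _ => exact h.elim

theorem substClosed_hierarchy (T : Set Sentence) (j : ℕ) :
    SubstClosed (SigmaCl T j) ∧ SubstClosed (PiCl T j) := by
  induction j with
  | zero =>
    rw [piCl_zero, and_self]
    intro n m φ τ h
    obtain ⟨ψ, h, e⟩ := sigmaCl_zero.1 h
    exact sigmaCl_zero.2 ⟨_, h.subst τ, e.subst τ⟩
  | succ j ih =>
    exact ⟨fun n m φ τ h => sigmaCl_succ.2 ((sigmaCl_succ.1 h).subst ih.2 τ),
      fun n m φ τ h => piCl_succ.2 ((piCl_succ.1 h).subst ih.1 τ)⟩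

theorem andClosed_hierarchy (T : Set Sentence) (j : ℕ) :
    AndClosed (SigmaCl T j) ∧ AndClosed (PiCl T j) := by
  induction j with
  | zero =>
    rw [piCl_zero, and_self]
    intro n φ ψ h h'
    obtain ⟨φ', h, e⟩ := sigmaCl_zero.1 h
    obtain ⟨ψ', h', e'⟩ := sigmaCl_zero.1 h'
    exact sigmaCl_zero.2 ⟨.and φ' ψ', ⟨h, h'⟩, e.and e'⟩
  | succ j ih =>
    have hs := substClosed_hierarchy T j
    exact ⟨fun n φ ψ h h' => sigmaCl_succ.2 ((sigmaCl_succ.1 h).and hs.2 ih.2 (sigmaCl_succ.1 h')),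
      fun n φ ψ h h' => piCl_succ.2 ((piCl_succ.1 h).and hs.1 ih.1 (piCl_succ.1 h'))⟩

theorem sigmaCl_subset_piCl_succ (j : ℕ) : ∀ n, SigmaCl T j n ⊆ PiCl T (j + 1) n :=
  fun _ _ h => piCl_succ.2 (.base h)

theorem piCl_subset_sigmaCl_succ (j : ℕ) : ∀ n, PiCl T j n ⊆ SigmaCl T (j + 1) n :=
  fun _ _ h => sigmaCl_succ.2 (.base h)

theorem subset_succ (T : Set Sentence) (j : ℕ) :
    (∀ n, SigmaCl T j n ⊆ SigmaCl T (j + 1) n) ∧ (∀ n, PiCl T j n ⊆ PiCl T (j + 1) n) := by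
  induction j with
  | zero =>
    have h1 := sigmaCl_subset_piCl_succ (T := T) 0
    have h2 := piCl_subset_sigmaCl_succ (T := T) 0
    rw [piCl_zero] at h2 ⊢
    exact ⟨h2, h1⟩
  | succ j ih =>
    exact ⟨fun n φ h => sigmaCl_succ.2 ((sigmaCl_succ.1 h).mono ih.2),
      fun n φ h => piCl_succ.2 ((piCl_succ.1 h).mono ih.1)⟩

theorem sigmaCl_subset {i j : ℕ} (h : i ≤ j) : SigmaCl T i n ⊆ SigmaCl T j n := by
  induction h with
  | refl => exact subset_rfl
  | step _ ih => exact ih.trans ((subset_succ T _).1 n)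

theorem ex_mem_sigmaCl {j : ℕ} {φ : Formula (n + 1)} (h : φ ∈ SigmaCl T (j + 1) (n + 1)) :
    .ex φ ∈ SigmaCl T (j + 1) n := sigmaCl_succ.2 (.ex (sigmaCl_succ.1 h))

-- Comparison with the literal `Σⱼ` and `Πⱼ` formulas

theorem ExCl.exs {m : ℕ} {φ : Formula (n + m)} (h : ExCl T K φ) : ExCl T K (exs m φ) := by
  induction m with
  | zero => exact h
  | succ m ih => exact ih h.ex

theorem AllCl.alls {m : ℕ} {φ : Formula (n + m)} (h : AllCl T K φ) : AllCl T K (alls m φ) := by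
  induction m with
  | zero => exact h
  | succ m ih => exact ih h.all

theorem mem_hierarchy_of_is (T : Set Sentence) (j : ℕ) :
    (∀ {n : ℕ} {φ : Formula n}, IsSigma j φ → φ ∈ SigmaCl T j n) ∧
      (∀ {n : ℕ} {φ : Formula n}, IsPi j φ → φ ∈ PiCl T j n) := by
  induction j with
  | zero =>
    simp only [piCl_zero, sigmaCl_zero, IsSigma, IsPi, and_self]
    exact fun h => ⟨_, h, .refl _⟩
  | succ j ih =>
    simp only [sigmaCl_succ, piCl_succ, IsSigma, IsPi]
    constructor
    · rintro n _ ⟨m, -, ψ, h, rfl⟩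
      exact .exs (.base (ih.2 h))
    · rintro n _ ⟨m, -, ψ, h, rfl⟩
      exact .alls (.base (ih.1 h))

/-- The cast only reassociates the count of variables. -/
theorem ex_exs {m : ℕ} (φ : Formula (n + 1 + m)) :
    .ex (exs m φ) = exs (m + 1) ((by omega : n + 1 + m = n + (m + 1)) ▸ φ) := by
  induction m with
  | zero => rfl
  | succ m ih =>
    have hcast : ∀ {a b : ℕ} (h : a = b) (h' : a + 1 = b + 1) (χ : Formula (a + 1)),
        h ▸ Formula.ex χ = Formula.ex (h' ▸ χ) := by
      rintro a _ rfl h' χ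
      rfl
    rw [exs, ih, hcast]
    rfl

theorem all_alls {m : ℕ} (φ : Formula (n + 1 + m)) :
    .all (alls m φ) = alls (m + 1) ((by omega : n + 1 + m = n + (m + 1)) ▸ φ) := by
  induction m with
  | zero => rfl
  | succ m ih =>
    have hcast : ∀ {a b : ℕ} (h : a = b) (h' : a + 1 = b + 1) (χ : Formula (a + 1)),
        h ▸ Formula.all χ = Formula.all (h' ▸ χ) := by
      rintro a _ rfl h' χ
      rfl
    rw [alls, ih, hcast]
    rfl

theorem mem_cast {a b : ℕ} (h : a = b) {φ : Formula a} (hφ : φ ∈ K a) :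
    (h ▸ φ : Formula b) ∈ K b := by
  subst h
  exact hφ

theorem ExCl.exists_exs (hs : SubstClosed K) (h : ExCl T K φ) :
    ∃ m, 1 ≤ m ∧ ∃ ψ ∈ K (n + m), Equivalent T (HeytingArith.exs m ψ) φ := by
  induction h with
  -- Blocks must be nonempty, so a vacuous quantifier is added.
  | base h => exact ⟨1, le_rfl, _, hs _ _ _ _ h, (Equivalent.ex_shift _).symm⟩
  | ex _ ih =>
    obtain ⟨m, hm, ψ, h, e⟩ := ih
    refine ⟨m + 1, by omega, _, mem_cast (by omega) h, ?_⟩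
    rw [← ex_exs]
    exact e.ex
  | congr e _ ih =>
    obtain ⟨m, hm, ψ, h, e'⟩ := ih
    exact ⟨m, hm, ψ, h, e'.trans e⟩

theorem AllCl.exists_alls (hs : SubstClosed K) (h : AllCl T K φ) :
    ∃ m, 1 ≤ m ∧ ∃ ψ ∈ K (n + m), Equivalent T (HeytingArith.alls m ψ) φ := by
  induction h with
  | base h => exact ⟨1, le_rfl, _, hs _ _ _ _ h, (Equivalent.all_shift _).symm⟩
  | all _ ih =>
    obtain ⟨m, hm, ψ, h, e⟩ := ih
    refine ⟨m + 1, by omega, _, mem_cast (by omega) h, ?_⟩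
    rw [← all_alls]
    exact e.all
  | congr e _ ih =>
    obtain ⟨m, hm, ψ, h, e'⟩ := ih
    exact ⟨m, hm, ψ, h, e'.trans e⟩

theorem exists_is_of_mem_hierarchy (T : Set Sentence) (j : ℕ) :
    (∀ {n : ℕ} {φ : Formula n}, φ ∈ SigmaCl T j n → ∃ ψ, IsSigma j ψ ∧ Equivalent T ψ φ) ∧
      (∀ {n : ℕ} {φ : Formula n}, φ ∈ PiCl T j n → ∃ ψ, IsPi j ψ ∧ Equivalent T ψ φ) := by
  induction j with
  | zero =>
    simp only [piCl_zero, sigmaCl_zero, IsSigma, IsPi, and_self]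
    exact id
  | succ j ih =>
    have hs := substClosed_hierarchy T j
    simp only [sigmaCl_succ, piCl_succ, IsSigma, IsPi]
    constructor
    · intro n φ h
      obtain ⟨m, hm, ψ, h, e⟩ := h.exists_exs hs.2
      obtain ⟨χ, h, e'⟩ := ih.2 h
      exact ⟨_, ⟨m, hm, χ, h, rfl⟩, e'.exs.trans e⟩
    · intro n φ h
      obtain ⟨m, hm, ψ, h, e⟩ := h.exists_alls hs.1
      obtain ⟨χ, h, e'⟩ := ih.1 h
      exact ⟨_, ⟨m, hm, χ, h, rfl⟩, e'.alls.trans e⟩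

/-! ## Stability and duality -/

/-- Double negation elimination holds for `φ`. -/
def Stable (T : Set Sentence) (φ : Formula n) : Prop :=
  ∀ w ρ, Force T w (.neg (.neg φ)) ρ → Force T w φ ρ

theorem Stable.by_contra (h : Stable T φ) {w : World} {ρ : Fin n → Elt}
    (h' : ∀ w', w ⊆ w' → Force T w' (.neg φ) ρ → Force T w' .bot Fin.elim0) : Force T w φ ρ :=
  h w ρ (Force.neg_iff.2 h')

theorem Stable.congr (e : Equivalent T φ ψ) (h : Stable T φ) : Stable T ψ :=
  fun w ρ h' => (e w ρ).1 (h w ρ ((e.neg.neg w ρ).2 h'))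

/-- `¬¬∀` implies `∀¬¬` intuitionistically, and `φ` is stable at each instance. -/
theorem Stable.all {φ : Formula (n + 1)} (h : Stable T φ) : Stable T (.all φ) := by
  refine fun w ρ h' => Force.all_iff.2 fun t => h.by_contra fun w1 h1 hn => ?_
  refine (h'.mono h1).neg_elim (Force.neg_iff.2 fun w2 h2 ha => ?_)
  exact (hn.mono h2).neg_elim (Force.all_iff.1 ha t)

theorem AllCl.stable (hK : ∀ n, ∀ φ ∈ K n, Stable T φ) (h : AllCl T K φ) : Stable T φ := by
  induction h with
  | base h => exact hK _ _ h
  | all _ ih => exact ih.all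
  | congr e _ ih => exact ih.congr e

theorem Equivalent.all_neg {φ : Formula (n + 1)} :
    Equivalent T (.all (.neg φ)) (.neg (.ex φ)) := by
  refine fun w ρ => ⟨fun h => Force.neg_iff.2 fun w1 h1 h' => ?_, fun h => ?_⟩
  · exact h'.exE fun w2 t h2 h' =>
      (Force.all_iff.1 (h.mono (List.Subset.trans h1 h2)) t).neg_elim h'
  · exact Force.all_iff.2 fun t => Force.neg_iff.2 fun w1 h1 h' => (h.mono h1).neg_elim (.exI t h')

/-- Only the direction from right to left needs stability: if there were no `t` with `¬φ t`,
stability of `φ` would give `∀ φ`; stability of `∃ ¬φ` then removes the double negation. -/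
theorem Equivalent.ex_neg {φ : Formula (n + 1)} (h1 : Stable T φ)
    (h2 : Stable T (.ex (.neg φ))) : Equivalent T (.ex (.neg φ)) (.neg (.all φ)) := by
  refine fun w ρ => ⟨fun h => h.exE fun w1 t _ h' => ?_, fun h => ?_⟩
  · exact Force.neg_iff.2 fun w2 hw h => (h'.mono hw).neg_elim (Force.all_iff.1 h t)
  · refine h2.by_contra fun w1 hw hn => (h.mono hw).neg_elim (Force.all_iff.2 fun t => ?_)
    exact h1.by_contra fun w2 hw h' => (hn.mono hw).neg_elim (.exI t h')

theorem Equivalent.ball_of_stable {φ : Formula (n + 1)} (h : Stable T φ) :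
    Equivalent T (.neg (.bex (.neg φ))) (.ball φ) := by
  intro w ρ
  rw [← Fin.cons_self_tail ρ]
  refine ⟨fun h' => ?_, fun h' => Force.neg_iff.2 fun w1 hw hb => ?_⟩
  · refine Force.ball_iff.2 fun w1 a hw hl => h.by_contra fun w2 hw' hn => ?_
    exact (h'.mono (List.Subset.trans hw hw')).neg_elim (.bexI (hl.mono hw') hn)
  · refine hb.bexE fun w2 a hw' hl hn => ?_
    exact hn.neg_elim (Force.ball_iff.1 h' w2 a (List.Subset.trans hw hw') hl)

theorem Equivalent.bex_of_stable {φ : Formula (n + 1)} (h : Stable T φ.bex) :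
    Equivalent T (.neg (.ball (.neg φ))) (.bex φ) := by
  intro w ρ
  rw [← Fin.cons_self_tail ρ]
  refine ⟨fun h' => h.by_contra fun w1 hw hn => ?_, fun h' => Force.neg_iff.2 fun w1 hw hb => ?_⟩
  · refine (h'.mono hw).neg_elim (Force.ball_iff.2 fun w2 a hw' hl => ?_)
    exact Force.neg_iff.2 fun w3 hw'' h' =>
      (hn.mono (List.Subset.trans hw' hw'')).neg_elim (.bexI (hl.mono hw'') h')
  · exact (h'.mono hw).bexE fun w2 a hw' hl h' =>
      (Force.ball_iff.1 hb w2 a hw' hl).neg_elim h'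

variable {k : ℕ}

/-- Negation exchanges the classes of the hierarchy, given double negation elimination. -/
theorem neg_mem_hierarchy (hD : ∀ n, ∀ φ ∈ SigmaCl T k n, Stable T φ) {j : ℕ} (hj : j ≤ k) :
    (∀ n, ∀ φ ∈ SigmaCl T j n, .neg φ ∈ PiCl T j n) ∧
      (∀ n, ∀ φ ∈ PiCl T j n, .neg φ ∈ SigmaCl T j n) := by
  induction j with
  | zero =>
    rw [piCl_zero, and_self]
    intro n φ h
    obtain ⟨ψ, h, e⟩ := sigmaCl_zero.1 h
    exact sigmaCl_zero.2 ⟨.neg ψ, ⟨h, trivial⟩, e.neg⟩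
  | succ j ih =>
    obtain ⟨ih1, ih2⟩ := ih (by omega)
    simp only [sigmaCl_succ, piCl_succ]
    constructor
    · intro n φ h
      induction h with
      | base h => exact .base (ih2 _ _ h)
      | ex _ ih => exact .congr .all_neg (.all ih)
      | congr e _ ih => exact .congr e.neg ih
    · intro n φ h
      induction h with
      | base h => exact .base (ih1 _ _ h)
      | all h ih =>
        -- The matrix is stable as a universal closure of `Σⱼ` formulas, and `∃ ¬φ` is stable
        -- because it is in `Σⱼ₊₁ ⊆ Σₖ`.
        refine .congr (.ex_neg ?_ ?_) (.ex ih)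
        · exact h.stable fun n φ h => hD n φ (sigmaCl_subset (by omega) h)
        · exact hD _ _ (sigmaCl_subset hj (sigmaCl_succ.2 (.ex ih)))
      | congr e _ ih => exact .congr e.neg ih

theorem stable_of_mem_piCl (hD : ∀ n, ∀ φ ∈ SigmaCl T k n, Stable T φ) {j : ℕ} (hj : j ≤ k)
    {φ : Formula n} (h : φ ∈ PiCl T j n) : Stable T φ := by
  cases j with
  | zero => rw [piCl_zero] at h; exact hD _ _ (sigmaCl_subset hj h)
  | succ j =>
    exact (piCl_succ.1 h).stable fun n φ h => hD n φ (sigmaCl_subset (by omega) h)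

/-- The formula `s < t` belongs to all levels of the hierarchy. -/
theorem lt_mem_sigmaCl (j : ℕ) (s t : Tm n) : .lt s t ∈ SigmaCl T j n :=
  sigmaCl_subset (Nat.zero_le j) (sigmaCl_zero.2 ⟨.lt s t, trivial, .refl _⟩)

/-- Write `∃ y < x, φ` as `¬∀ y < x, ¬φ` and apply duality twice. The rewriting needs the stability
of the bounded existential formula, which is known only as a `Σⱼ₊₁` formula; hence `j + 1 ≤ k`. -/
theorem bexClosed_piCl (hD : ∀ n, ∀ φ ∈ SigmaCl T k n, Stable T φ) {j : ℕ} (hj : j + 1 ≤ k)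
    (hb : BallClosed (SigmaCl T j)) : BexClosed (PiCl T j) := by
  intro n φ h
  have hn := neg_mem_hierarchy hD (Nat.le_of_succ_le hj)
  refine piCl_congr (.bex_of_stable (hD _ _ (sigmaCl_subset hj ?_)))
    (hn.1 _ _ (hb _ _ (hn.2 _ _ h)))
  refine ex_mem_sigmaCl ((andClosed_hierarchy T _).1 _ _ _ (lt_mem_sigmaCl _ _ _) ?_)
  exact (substClosed_hierarchy T _).1 _ _ _ _ (piCl_subset_sigmaCl_succ _ _ h)

end Hierarchy

/-! ## Contraction of quantifiers and collection -/

/-- Exchange of the first two variables. -/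
def Formula.swap {n : ℕ} (φ : Formula (n + 2)) : Formula (n + 2) :=
  φ.subst (Fin.cons (v 1) (Fin.cons (v 0) fun i => v i.succ.succ))

/-- Identification of the first two variables. -/
def Formula.diag {n : ℕ} (φ : Formula (n + 2)) : Formula (n + 1) :=
  φ.subst (Fin.cons (v 0) v)

section Collection

variable {T : Set Sentence} {n m : ℕ} {K : FormulaSet} {w w' : World}

@[simp] theorem Force.swap_iff {φ : Formula (n + 2)} {a b : Elt} {ρ : Fin n → Elt} :
    Force T w φ.swap (Fin.cons a (Fin.cons b ρ)) ↔ Force T w φ (Fin.cons b (Fin.cons a ρ)) := by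
  rw [Formula.swap, Force.subst_iff]
  congr! 1
  funext i
  exact Fin.cases rfl (fun j => Fin.cases rfl (fun j => rfl) j) i

@[simp] theorem Force.diag_iff {φ : Formula (n + 2)} {a : Elt} {ρ : Fin n → Elt} :
    Force T w φ.diag (Fin.cons a ρ) ↔ Force T w φ (Fin.cons a (Fin.cons a ρ)) := by
  rw [Formula.diag, Force.subst_iff]
  congr! 1
  funext i
  exact Fin.cases rfl (fun j => rfl) i

variable [hT : ExtendsHA T]

/-- `∃ z₁ z₂, φ` is equivalent to `∃ u, ∃ z₁ < u, ∃ z₂ < u, φ`. -/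
theorem Equivalent.ex_ex (φ : Formula (n + 2)) :
    Equivalent T (.ex φ.bex.swap.bex.diag) (.ex (.ex φ)) := by
  refine fun w ρ => ⟨fun h => h.exE fun w1 u _ h => ?_, fun h => h.exE fun w1 z _ h => ?_⟩
  · rw [Force.diag_iff] at h
    refine h.bexE fun w2 z _ _ h => .exI z ?_
    rw [Force.swap_iff] at h
    exact h.bexE fun w3 z' _ _ h => .exI z' h
  -- The bound `u` is a common strict upper bound of the two witnesses.
  · refine h.exE fun w2 z' _ h => LeF.exists_upper z z' fun w3 u hw h1 h2 => .exI u ?_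
    rw [Force.diag_iff]
    refine .bexI h1 ?_
    rw [Force.swap_iff]
    exact .bexI h2 (h.mono hw)

/-- `∀ z₁ z₂, φ` is equivalent to `∀ u, ∀ z₁ < u, ∀ z₂ < u, φ`. -/
theorem Equivalent.all_all (φ : Formula (n + 2)) :
    Equivalent T (.all φ.ball.swap.ball.diag) (.all (.all φ)) := by
  refine fun w ρ => ⟨fun h => ?_, fun h => ?_⟩
  · refine Force.all_iff.2 fun z => Force.all_iff.2 fun z' => ?_
    refine LeF.exists_upper z z' fun w1 u hw h1 h2 => ?_
    have h3 := Force.diag_iff.1 (Force.all_iff.1 (h.mono hw) u)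
    have h4 := Force.swap_iff.1 (Force.ball_iff.1 h3 w1 z (List.Subset.refl _) h1)
    exact Force.ball_iff.1 h4 w1 z' (List.Subset.refl _) h2
  · refine Force.all_iff.2 fun u => Force.diag_iff.2 (Force.ball_iff.2 fun w1 z hw _ => ?_)
    refine Force.swap_iff.2 (Force.ball_iff.2 fun w2 z' hw' _ => ?_)
    exact (Force.all_iff.1 (Force.all_iff.1 h z) z').mono (List.Subset.trans hw hw')

/-- Each further quantifier is merged with the previous one by `Equivalent.ex_ex`; the two bounded
quantifiers this creates are absorbed by `K`. -/
theorem ExCl.exists_ex (hs : SubstClosed K) (hb : BexClosed K)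
    {φ : Formula n} (h : ExCl T K φ) : ∃ ψ ∈ K (n + 1), Equivalent T (.ex ψ) φ := by
  induction h with
  | base h => exact ⟨_, hs _ _ _ _ h, (Equivalent.ex_shift _).symm⟩
  | ex _ ih =>
    obtain ⟨ψ, h, e⟩ := ih
    exact ⟨_, hs _ _ _ _ (hb _ _ (hs _ _ _ _ (hb _ _ h))), (Equivalent.ex_ex ψ).trans e.ex⟩
  | congr e _ ih =>
    obtain ⟨ψ, h, e'⟩ := ih
    exact ⟨ψ, h, e'.trans e⟩

theorem AllCl.exists_all (hs : SubstClosed K) (hb : BallClosed K)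
    {φ : Formula n} (h : AllCl T K φ) : ∃ ψ ∈ K (n + 1), Equivalent T (.all ψ) φ := by
  induction h with
  | base h => exact ⟨_, hs _ _ _ _ h, (Equivalent.all_shift _).symm⟩
  | all _ ih =>
    obtain ⟨ψ, h, e⟩ := ih
    exact ⟨_, hs _ _ _ _ (hb _ _ (hs _ _ _ _ (hb _ _ h))), (Equivalent.all_all ψ).trans e.all⟩
  | congr e _ ih =>
    obtain ⟨ψ, h, e'⟩ := ih
    exact ⟨ψ, h, e'.trans e⟩

/-- Collection: `∀ y < x, ∃ z, φ` is equivalent to `∃ u, ∀ y < x, ∃ z < u, φ`. -/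
theorem Equivalent.collection (φ : Formula (n + 2)) :
    Equivalent T (.ex φ.bex.swap.ball.swap) (.ball (.ex φ)) := by
  intro w ρ
  rw [← Fin.cons_self_tail ρ]
  refine ⟨fun h => h.exE fun w1 u _ h => Force.ball_iff.2 fun w2 y hw hl => ?_, ?_⟩
  · rw [Force.swap_iff, Force.ball_iff] at h
    exact (Force.swap_iff.1 (h w2 y hw hl)).bexE fun w3 z _ _ h => .exI z h
  -- Induction on the bound `x`.
  · refine Force.mp (Force.induction (φ := .imp (.ball (.ex φ)) (.ex φ.bex.swap.ball.swap))
      ?_ (fun w1 x _ ih => ?_) (ρ 0))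
    · refine Force.imp_iff.2 fun w1 _ _ => .exI zeroE (Force.swap_iff.2 Force.ball_zero)
    · refine Force.imp_iff.2 fun w2 hw h => ?_
      rw [Force.ball_succ_iff] at h
      refine ((ih.mono hw).mp h.1).exE fun w3 u hw3 hu => ?_
      refine (h.2.mono hw3).exE fun w4 z hw4 hz => ?_
      -- The new bound `u'` lies above the old bound `u` and the witness `z` for the new element
      -- `x`.
      refine LeF.exists_upper z u fun w5 u' hw5 h1 h2 => .exI u' ?_
      have hu' := Force.ball_iff.1 (Force.swap_iff.1 (hu.mono (List.Subset.trans hw4 hw5)))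
      refine Force.swap_iff.2 (Force.ball_succ_iff.2 ⟨Force.ball_iff.2 fun w6 y hw6 hl => ?_, ?_⟩)
      · refine Force.swap_iff.2 ((Force.swap_iff.1 (hu' w6 y hw6 hl)).bexE
          fun w7 z' hw7 hl' hz' => .bexI (hl'.trans ?_) hz')
        exact ((LeF.succ_self u).trans h2).mono (List.Subset.trans hw6 hw7)
      · exact Force.swap_iff.2 (.bexI h1 (hz.mono hw5))

variable {k : ℕ}

theorem ballClosed_sigmaCl_zero : BallClosed (SigmaCl T 0) := by
  intro n φ h
  obtain ⟨ψ, h, e⟩ := sigmaCl_zero.1 h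
  obtain ⟨f, hf⟩ := h.exists_represents (T := T)
  refine sigmaCl_zero.2 ⟨.eq (app (ballSymb f) v) zeroTm, trivial, .trans (fun w ρ => ?_) e.ball⟩
  rw [Force.eq_iff, app_subst, zeroTm_subst]
  exact (hf.ball w ρ).symm

/-- For `j > 0`, `∀ y < x, φ` is `¬∃ y < x, ¬φ` by stability of `φ`; the bounded existential formula
is `Σⱼ` simply because an unbounded `∃` is. -/
theorem ballClosed_piCl (hD : ∀ n, ∀ φ ∈ SigmaCl T k n, Stable T φ) {j : ℕ} (hj : j ≤ k) :
    BallClosed (PiCl T j) := by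
  cases j with
  | zero => rw [piCl_zero]; exact ballClosed_sigmaCl_zero
  | succ j =>
    intro n φ h
    have hn := neg_mem_hierarchy hD hj
    refine piCl_congr (.ball_of_stable (stable_of_mem_piCl hD hj h)) (hn.1 _ _ ?_)
    refine ex_mem_sigmaCl ((andClosed_hierarchy T _).1 _ _ _ (lt_mem_sigmaCl _ _ _) ?_)
    exact (substClosed_hierarchy T _).1 _ _ _ _ (hn.2 _ _ h)

/-- With one existential quantifier left, collection moves it outside `∀ y < x`. What remains is a
`Πⱼ` matrix under two bounded quantifiers; the existential one is handled by the induction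
hypothesis through `bexClosed_piCl`. -/
theorem ballClosed_sigmaCl (hD : ∀ n, ∀ φ ∈ SigmaCl T k n, Stable T φ) {j : ℕ} (hj : j ≤ k) :
    BallClosed (SigmaCl T j) := by
  induction j with
  | zero => exact ballClosed_sigmaCl_zero
  | succ j ih =>
    intro n φ h
    have hs := (substClosed_hierarchy T j).2
    have hbex := bexClosed_piCl hD hj (ih (by omega))
    have hball := ballClosed_piCl hD (Nat.le_of_succ_le hj)
    obtain ⟨ψ, h, e⟩ := (sigmaCl_succ.1 h).exists_ex hs hbex
    refine sigmaCl_congr (.trans (.collection ψ) e.ball) (sigmaCl_succ.2 (.ex (.base ?_)))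
    exact hs _ _ _ _ (hball _ _ (hs _ _ _ _ (hbex _ _ h)))

/-! ## De Morgan's law -/

/-- De Morgan's law for `∀ x, A` and `∀ y, B`, from De Morgan's law for the formulas
`∃ x, ¬A x ∧ ∀ y < x, B y` and `∃ y, (¬B y ∧ ∀ x < y, A x) ∧ A y`. -/
theorem Force.deMorgan_all {A B : Formula (n + 1)} (hA : Stable T A) (hB : Stable T B)
    {ρ : Fin n → Elt}
    (h : ∀ {P Q : Formula n}, P = .ex (.and (.neg A) B.ball) →
      Q = .ex (.and (.and (.neg B) A.ball) A) →
      Force T w (.imp (.neg (.and P Q)) (.or (.neg P) (.neg Q))) ρ)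
    (hAB : Force T w (.neg (.and (.all A) (.all B))) ρ) :
    Force T w (.or (.neg (.all A)) (.neg (.all B))) ρ := by
  refine ((h rfl rfl).mp ?_).orE (fun w1 hw h => Force.orI₂ ?_) fun w1 hw h => Force.orI₁ ?_
  -- `P ∧ Q` is refuted by comparing their witnesses `x` and `y`.
  · refine Force.neg_iff.2 fun w1 _ h => (Force.and_iff.1 h).1.exE fun w2 x hw2 hx =>
      ((Force.and_iff.1 h).2.mono hw2).exE fun w3 y hw3 hy => ?_
    have hx := (Force.and_iff.1 (hx.mono hw3))
    obtain ⟨hy, hAy⟩ := Force.and_iff.1 hy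
    have hy := Force.and_iff.1 hy
    refine LeF.total x y (fun w4 hw4 hl => ?_) fun w4 hw4 hl => ?_
    · refine hl.lt_or_eq (fun w5 hw5 hl => ?_) fun w5 hw5 he => ?_
      · have hw := List.Subset.trans hw4 hw5
        exact (hx.1.mono hw).neg_elim (Force.ball_iff.1 hy.2 w5 x hw hl)
      -- The tie `x = y`, excluded by the last conjunct `A y` of `Q`.
      · have hw := List.Subset.trans hw4 hw5
        exact (hx.1.mono hw).neg_elim (he.symm.leibniz (hAy.mono hw))
    · exact (hy.1.mono hw4).neg_elim (Force.ball_iff.1 hx.2 w4 y hw4 hl)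
  -- Case `¬P`: given `∀ B`, any `x` with `¬A x` would witness `P`, so `∀ A` by stability.
  · refine Force.neg_iff.2 fun w2 hw2 hb => (hAB.mono (List.Subset.trans hw hw2)).neg_elim
      (Force.and_iff.2 ⟨Force.all_iff.2 fun x => hA.by_contra fun w3 hw3 hn => ?_, hb⟩)
    refine (h.mono (List.Subset.trans hw2 hw3)).neg_elim (.exI x (Force.and_iff.2 ⟨hn, ?_⟩))
    exact Force.ball_iff.2 fun w4 y hw4 _ =>
      (Force.all_iff.1 hb y).mono (List.Subset.trans hw3 hw4)
  -- Case `¬Q`: given `∀ A`, any `y` with `¬B y` would witness `Q`.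
  · refine Force.neg_iff.2 fun w2 hw2 ha => (hAB.mono (List.Subset.trans hw hw2)).neg_elim
      (Force.and_iff.2 ⟨ha, Force.all_iff.2 fun y => hB.by_contra fun w3 hw3 hn => ?_⟩)
    refine (h.mono (List.Subset.trans hw2 hw3)).neg_elim (.exI y (Force.and_iff.2
      ⟨Force.and_iff.2 ⟨hn, ?_⟩, (Force.all_iff.1 ha y).mono hw3⟩))
    exact Force.ball_iff.2 fun w4 x hw4 _ =>
      (Force.all_iff.1 ha x).mono (List.Subset.trans hw3 hw4)

/-- After contraction, `¬A` and `¬B` are `Πₖ`, while the bounded quantifications of `A` and `B` are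
`Σₖ`. All of these are `Σₖ₊₁`, a class closed under `∧` and `∃`, so `P` and `Q` fall under `hM`. -/
theorem Force.deMorgan_piCl (hD : ∀ n, ∀ φ ∈ SigmaCl T k n, Stable T φ)
    (hM : ∀ w n, ∀ φ ∈ SigmaCl T (k + 1) n, ∀ ψ ∈ SigmaCl T (k + 1) n, ∀ ρ,
      Force T w (.imp (.neg (.and φ ψ)) (.or (.neg φ) (.neg ψ))) ρ)
    {φ ψ : Formula n} (hφ : φ ∈ PiCl T (k + 1) n) (hψ : ψ ∈ PiCl T (k + 1) n) (ρ : Fin n → Elt) :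
    Force T w (.imp (.neg (.and φ ψ)) (.or (.neg φ) (.neg ψ))) ρ := by
  have hs := (substClosed_hierarchy T k).1
  have hb := ballClosed_sigmaCl hD le_rfl
  have hn := (neg_mem_hierarchy hD le_rfl).1
  have ha := (andClosed_hierarchy T (k + 1)).1
  have hk := (subset_succ T k).1
  have hk' := piCl_subset_sigmaCl_succ (T := T) k
  obtain ⟨A, hA, eA⟩ := (piCl_succ.1 hφ).exists_all hs hb
  obtain ⟨B, hB, eB⟩ := (piCl_succ.1 hψ).exists_all hs hb
  refine (eA.deMorgan eB w ρ).1 (Force.imp_iff.2 fun w1 _ h => ?_)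
  refine Force.deMorgan_all (hD _ _ hA) (hD _ _ hB) (fun hP hQ => hM _ _ _ ?_ _ ?_ _) h
  · rw [hP]
    exact ex_mem_sigmaCl (ha _ _ _ (hk' _ (hn _ _ hA)) (hk _ (hb _ _ hB)))
  · rw [hQ]
    exact ex_mem_sigmaCl (ha _ _ _ (ha _ _ _ (hk' _ (hn _ _ hB)) (hk _ (hb _ _ hA))) (hk _ hA))

end Collection

-- From the axiom schemes to the theorem

theorem close_mem_plus {T : Set Sentence} {P : FormulaSet} {n : ℕ} {φ : Formula n}
    (h : φ ∈ P n) : φ.close ∈ plus T P := Or.inr ⟨n, φ, h, rfl⟩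

end HeytingArith

open HeytingArith in
theorem mainTheorem4 (k : ℕ) :
    HeytingArith.Proves
      (HeytingArith.plus
        (HeytingArith.plus HeytingArith.HA (HeytingArith.DML (HeytingArith.SigmaSet (k : ℤ))))
        (HeytingArith.DNE (HeytingArith.SigmaSet ((k : ℤ) - 1))))
      (HeytingArith.DML (HeytingArith.PiSet (k : ℤ))) := by
  rintro n _ ⟨φ, hφ, ψ, hψ, rfl⟩
  refine Force.derives fun ρ => ?_
  cases k with
  | zero =>
    -- Since `Σ₀` and `Π₀` are both the quantifier-free formulas, the instance is an axiom.
    refine Force.axiom_close (Or.inl (close_mem_plus (P := DML _) ⟨φ, ?_, ψ, ?_, rfl⟩)) ρ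
    · exact hφ
    · exact hψ
  | succ k =>
    rw [show ((k + 1 : ℕ) : ℤ) - 1 = (k : ℤ) by push_cast; ring]
    set T := plus (plus HA (DML (SigmaSet ((k + 1 : ℕ) : ℤ)))) (DNE (SigmaSet (k : ℤ)))
    have : ExtendsHA T := ⟨fun _ h => Or.inl (Or.inl h)⟩
    refine Force.deMorgan_piCl (k := k) (fun n φ h => ?_) (fun w n φ hφ ψ hψ ρ => ?_)
      ((mem_hierarchy_of_is T (k + 1)).2 hφ) ((mem_hierarchy_of_is T (k + 1)).2 hψ) ρ
    -- The axioms concern literal `Σ` formulas; stability and De Morgan's law pass to everything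
    -- equivalent to one.
    · obtain ⟨ψ, h, e⟩ := (exists_is_of_mem_hierarchy T k).1 h
      exact Stable.congr e fun w ρ =>
        (Force.axiom_close (T := T) (close_mem_plus (P := DNE _) ⟨ψ, h, rfl⟩) ρ).mp
    · obtain ⟨φ', hφ', e⟩ := (exists_is_of_mem_hierarchy T (k + 1)).1 hφ
      obtain ⟨ψ', hψ', e'⟩ := (exists_is_of_mem_hierarchy T (k + 1)).1 hψ
      refine (e.deMorgan e' w ρ).1 (Force.axiom_close (Or.inl ?_) ρ)
      exact close_mem_plus (P := DML _) ⟨φ', hφ', ψ', hψ', rfl⟩
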